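/- **Setting.** Alphabets are finite and discrete. A subshift over $\mathcal B$ is a closed set $X\subseteq\mathcal B^{\mathbb Z}$ with $S(X)=X$, where $(Sx)_n=x_{n+1}$; it is minimal if every orbit $\{S^nx:n\in\mathbb Z\}$, $x\in X$, is dense in $X$. Its language $\mathcal L(X)$ is the set of finite words occurring in points of $X$. A non-erasing morphism $\tau:\mathcal A^*\to\mathcal B^*$ (all $\tau(a)$ non-empty) acts on $y\in\mathcal A^{\mathbb Z}$ by $\tau(y)=\cdots\tau(y_{-1}).\tau(y_0)\tau(y_1)\cdots$, where $\tau(y_0)$ starts at coordinate $0$. For $Y\subseteq\mathcal A^{\mathbb Z}$, $\tau$ is *recognizable in $Y$* if for every $x\in\mathcal B^{\mathbb Z}$ there is at most one pair $(k,y)$ with $y\in Y$, $0\le k<|\tau(y_0)|$ and $x=S^k\tau(y)$. A finite set $\mathcal W\subset\mathcal B^*$ of non-empty words is *recognizable in $X$* if there are a finite alphabet $\mathcal A$, a subshift $Y\subseteq\mathcal A^{\mathbb Z}$ and a morphism $\tau:\mathcal A^*\to\mathcal B^*$ with $\tau(\mathcal A)=\mathcal W$ such that $X=\bigcup_{k\in\mathbb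 Z}S^k\tau(Y)$ and $\tau$ is recognizable in $Y$. Put $$K(X)=\lim_{n\to\infty}\ \inf\{|\mathcal W| : \mathcal W\subseteq\mathcal L(X),\ |w|\ge n \text{ for all } w\in\mathcal W,\ \mathcal W\text{ recognizable in }X\}\in\mathbb N\cup\{+\infty\},$$ with $\inf\emptyset=+\infty$ (the limit of a non-decreasing sequence). An *ordered Bratteli diagram* has finite vertex sets $V_0,V_1,\dots$ with $|V_0|=1$, finite edge sets $E_n$ ($n\ge1$) with surjective source and range maps $\mathsf s:E_n\to V_{n-1}$, $\mathsf r:E_n\to V_n$, and a partial order on each $E_n$ in which two edges are comparable iff they have the same range. It is *simple* if for every $n\ge1$ there is $N>n$ such that every $u\in V_n$ is joined by a path to every $v\in V_N$. Let $X_B$ be the space of infinite paths from $V_0$, with the topology generated by cylinders. The diagram is *properly ordered* if exactly one path in $X_B$ has all its edges maximal and exactly one has all its edges minimal. The Vershik map $V_B:X_B\to X_B$ sends the former path to the latter; for any other path it replaces the first non-maximal edge by its successor, replaces the edges before it by the path of minimal edges ending at the source of the new edge, and keeps the later edges. A minimal Cantor system has *finite topological rank* if it is topologically conjugate to $(X_B,V_B)$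 for some simple properly ordered Bratteli diagram whose numbers of vertices $|V_n|$ are bounded uniformly in $n$. **Theorem.** Let $(X,S)$ be an infinite minimal subshift over a finite alphabet (so that it is a minimal Cantor system). Then $(X,S)$ has finite topological rank if and only if $K(X)<+\infty$. -/

import Mathlib

open Set Filter Topology

/-! ## Topological dynamics -/

/-- A homeomorphism is minimal if every two-sided orbit is dense. -/
def IsMinimalHomeo {X : Type*} [TopologicalSpace X] (T : X ≃ₜ X) : Prop :=
  ∀ x : X, Dense (Set.range fun n : ℤ => (T ^ n) x)

/-! ## Subshifts -/

/-- The shift `(S x)_n = x_{n+1}` on two-sided sequences. -/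
def shiftHomeo (A : Type*) [TopologicalSpace A] : (ℤ → A) ≃ₜ (ℤ → A) where
  toFun x := fun n => x (n + 1)
  invFun x := fun n => x (n - 1)
  left_inv x := by funext n; simp
  right_inv x := by funext n; simp
  continuous_toFun := by fun_prop
  continuous_invFun := by fun_prop

/-- `S^k x` for `k : ℤ`. -/
def shiftBy {A : Type*} (k : ℤ) (x : ℤ → A) : ℤ → A := fun n => x (n + k)

/-- A subshift: a closed shift-invariant set of two-sided sequences (the alphabet is meant to be
finite and discrete). -/
structure Subshift (A : Type*) [TopologicalSpace A] where
  carrier : Set (ℤ → A)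
  isClosed : IsClosed carrier
  image_shift : shiftHomeo A '' carrier = carrier

namespace Subshift

variable {A : Type*} [TopologicalSpace A]

theorem mem_iff_shift_mem (X : Subshift A) (x : ℤ → A) :
    x ∈ X.carrier ↔ shiftHomeo A x ∈ X.carrier := by
  constructor
  · intro h
    rw [← X.image_shift]
    exact mem_image_of_mem _ h
  · intro h
    rw [← X.image_shift] at h
    obtain ⟨y, hy, hyx⟩ := h
    exact (shiftHomeo A).injective hyx ▸ hy

/-- The shift as a homeomorphism of the subshift. -/
def shift (X : Subshift A) : X.carrier ≃ₜ X.carrier :=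
  (shiftHomeo A).subtype X.mem_iff_shift_mem

/-- The language of a subshift: all the words that occur in its points. -/
def language (X : Subshift A) : Set (List A) :=
  {w | ∃ x ∈ X.carrier, ∃ m : ℤ, ∀ (i : ℕ) (hi : i < w.length), x (m + i) = w[i]}

end Subshift

/-! ## Non-erasing morphisms and recognizability -/

/-- A non-erasing morphism of free monoids `A* → B*`, given by the images of the letters. -/
structure WordMorphism (A B : Type*) where
  word : A → List B
  word_ne_nil : ∀ a, word a ≠ []

namespace WordMorphism

variable {A B : Type*}

/-- The cut positions of `τ(y)`: the word `τ(y_k)` occupies the positions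
`[cut k, cut (k+1))` of `τ(y)`, and `cut 0 = 0`. -/
def cut (τ : WordMorphism A B) (y : ℤ → A) : ℤ → ℤ
  | Int.ofNat n => ∑ i ∈ Finset.range n, ((τ.word (y i)).length : ℤ)
  | Int.negSucc n => -∑ i ∈ Finset.range (n + 1), ((τ.word (y (-(i + 1 : ℤ)))).length : ℤ)

theorem cut_zero (τ : WordMorphism A B) (y : ℤ → A) : τ.cut y 0 = 0 := by
  change τ.cut y (Int.ofNat 0) = 0
  simp [cut]

theorem cut_add_one (τ : WordMorphism A B) (y : ℤ → A) (k : ℤ) :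
    τ.cut y (k + 1) = τ.cut y k + (τ.word (y k)).length := by
  rcases k with n | n
  · change τ.cut y (Int.ofNat (n + 1)) = _
    simp only [cut, Finset.sum_range_succ, Int.ofNat_eq_natCast]
  · rcases n with _ | n
    · change τ.cut y (Int.ofNat 0) = _
      simp [cut]
    · change τ.cut y (Int.negSucc n) = _
      simp only [cut]
      rw [Finset.sum_range_succ _ (n + 1)]
      have : (-(((n + 1 : ℕ) : ℤ) + 1)) = Int.negSucc (n + 1) := by
        rw [Int.negSucc_eq]
      rw [this]
      ring

theorem cut_strictMono (τ : WordMorphism A B) (y : ℤ → A) : StrictMono (τ.cut y) := by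
  refine strictMono_int_of_lt_succ fun k => ?_
  rw [cut_add_one]
  have := List.length_pos_iff.2 (τ.word_ne_nil (y k))
  omega

theorem exists_cut (τ : WordMorphism A B) (y : ℤ → A) (i : ℤ) :
    ∃ k : ℤ, τ.cut y k ≤ i ∧ i < τ.cut y (k + 1) := by
  have hup : ∀ n : ℕ, (n : ℤ) ≤ τ.cut y n := by
    intro n
    induction n with
    | zero => simp [cut_zero]
    | succ n ih =>
      have := τ.cut_strictMono y (show (n : ℤ) < (n + 1 : ℕ) by push_cast; omega)
      push_cast at *
      omega
  have hdn : ∀ n : ℕ, τ.cut y (-n) ≤ -n := by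
    intro n
    induction n with
    | zero => simp [cut_zero]
    | succ n ih =>
      have := τ.cut_strictMono y (show (-(n + 1 : ℕ) : ℤ) < -n by push_cast; omega)
      push_cast at *
      omega
  obtain ⟨a, ha1, ha2⟩ : ∃ a : ℕ, i ≤ a ∧ -(a : ℤ) ≤ i := ⟨i.natAbs, by omega, by omega⟩
  obtain ⟨k, hk, hmax⟩ := Int.exists_greatest_of_bdd (P := fun k => τ.cut y k ≤ i)
    ⟨a, fun z hz => by
      by_contra hlt
      have h1 := τ.cut_strictMono y (not_le.1 hlt)
      have h2 := hup a
      omega⟩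
    ⟨-(a : ℤ), (hdn a).trans ha2⟩
  refine ⟨k, hk, ?_⟩
  by_contra h
  have := hmax (k + 1) (not_lt.1 h)
  omega

/-- `x` is the concatenation `⋯ τ(y_{-1}) . τ(y_0) τ(y_1) ⋯`, where `τ(y_0)` starts at `0`. -/
def IsImage (τ : WordMorphism A B) (y : ℤ → A) (x : ℤ → B) : Prop :=
  ∀ (k : ℤ) (j : ℕ) (hj : j < (τ.word (y k)).length), x (τ.cut y k + j) = (τ.word (y k))[j]

theorem existsUnique_isImage (τ : WordMorphism A B) (y : ℤ → A) : ∃! x, τ.IsImage y x := by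
  choose k hk1 hk2 using τ.exists_cut y
  have hlt : ∀ i, (i - τ.cut y (k i)).toNat < (τ.word (y (k i))).length := by
    intro i
    have h1 := hk1 i
    have h2 := hk2 i
    rw [cut_add_one] at h2
    omega
  refine ⟨fun i => (τ.word (y (k i)))[(i - τ.cut y (k i)).toNat]'(hlt i), ?_, ?_⟩
  · intro l j hj
    have hl : k (τ.cut y l + j) = l := by
      have h1 := hk1 (τ.cut y l + j)
      have h2 := hk2 (τ.cut y l + j)
      have h3 : τ.cut y l + j < τ.cut y (l + 1) := by rw [cut_add_one]; omega
      have h4 := (τ.cut_strictMono y).lt_iff_lt.1 (lt_of_le_of_lt h1 h3)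
      have h5 := (τ.cut_strictMono y).lt_iff_lt.1
        (lt_of_le_of_lt (show τ.cut y l ≤ τ.cut y l + j by omega) h2)
      omega
    simp [hl]
  · intro x hx
    funext i
    have h := hx (k i) _ (hlt i)
    rw [← h]
    congr 1
    have := hk1 i
    omega

/-- The two-sided sequence `τ(y)`. -/
noncomputable def apply (τ : WordMorphism A B) (y : ℤ → A) : ℤ → B :=
  (τ.existsUnique_isImage y).choose

theorem isImage_apply (τ : WordMorphism A B) (y : ℤ → A) : τ.IsImage y (τ.apply y) :=
  (τ.existsUnique_isImage y).choose_spec.1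

/-- `(k, y)` is a centered `τ`-representation of `x` in `Y`:
`x = S^k τ(y)`, `y ∈ Y` and `0 ≤ k < |τ(y_0)|`. -/
def IsCenteredRepr (τ : WordMorphism A B) (Y : Set (ℤ → A)) (x : ℤ → B) (k : ℤ) (y : ℤ → A) :
    Prop :=
  y ∈ Y ∧ 0 ≤ k ∧ k < (τ.word (y 0)).length ∧ x = shiftBy k (τ.apply y)

/-- `τ` is recognizable in `Y`: each `x` has at most one centered `τ`-representation in `Y`. -/
def IsRecognizable (τ : WordMorphism A B) (Y : Set (ℤ → A)) : Prop :=
  ∀ (x : ℤ → B) (k k' : ℤ) (y y' : ℤ → A),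
    τ.IsCenteredRepr Y x k y → τ.IsCenteredRepr Y x k' y' → k = k' ∧ y = y'

end WordMorphism

namespace Subshift

variable {B : Type*} [TopologicalSpace B]

/-- The set of words `W` is recognizable in `X`: for some finite alphabet `A` (written `Fin m`),
some subshift `Y ⊆ A^ℤ` and some (non-erasing) morphism `τ` with `τ(A) = W`, the subshift `X`
is the union of the `S^k τ(Y)` (the smallest subshift containing `τ(Y)`), and `τ` is recognizable
in `Y`. In particular `W` is finite and consists of non-empty words. The morphism `τ` is not
required to be injective on letters. -/
def RecognizableSet (X : Subshift B) (W : Set (List B)) : Prop :=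
  ∃ (m : ℕ) (Y : Subshift (Fin m)) (τ : WordMorphism (Fin m) B),
    Set.range τ.word = W ∧
    X.carrier = ⋃ k : ℤ, (fun y => shiftBy k (τ.apply y)) '' Y.carrier ∧
    τ.IsRecognizable Y.carrier

/-- The least cardinality of a set of words of length at least `n` in the language of `X` that is
recognizable in `X` (`⊤` if there is none). -/
noncomputable def minRecognizableCard (X : Subshift B) (n : ℕ) : ℕ∞ :=
  ⨅ (W : Set (List B)) (_ : W ⊆ {w | w ∈ X.language ∧ n ≤ w.length})
    (_ : X.RecognizableSet W), W.encard

/-- The limit `K(X)` of these cardinalities as `n → ∞`, with values in `ℕ ∪ {∞}`. -/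
noncomputable def K (X : Subshift B) : ℕ∞ := limUnder atTop X.minRecognizableCard

theorem minRecognizableCard_mono (X : Subshift B) : Monotone X.minRecognizableCard := by
  intro n n' h
  refine le_iInf fun W => le_iInf fun hW => le_iInf fun hR => ?_
  exact iInf_le_of_le W (iInf_le_of_le (fun w hw => ⟨(hW hw).1, h.trans (hW hw).2⟩)
    (iInf_le _ hR))

theorem tendsto_minRecognizableCard (X : Subshift B) :
    Tendsto X.minRecognizableCard atTop (𝓝 X.K) :=
  tendsto_nhds_limUnder ⟨_, tendsto_atTop_iSup X.minRecognizableCard_mono⟩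

end Subshift

/-! ## Ordered Bratteli diagrams and Bratteli-Vershik systems -/

/-- An ordered Bratteli diagram. `V n` is the set of vertices of level `n`, and `E n` is the set of
edges from level `n` to level `n + 1`. Two edges are comparable if and only if they have the same
range. -/
structure OrderedBratteliDiagram where
  V : ℕ → Type
  E : ℕ → Type
  finite_V : ∀ n, Finite (V n)
  finite_E : ∀ n, Finite (E n)
  card_V_zero : Nat.card (V 0) = 1
  source : ∀ {n}, E n → V n
  range : ∀ {n}, E n → V (n + 1)
  source_surjective : ∀ n, Function.Surjective (source : E n → V n)
  range_surjective : ∀ n, Function.Surjective (range : E n → V (n + 1))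
  order : ∀ n, PartialOrder (E n)
  comparable_iff : ∀ {n} (e f : E n), (e ≤ f ∨ f ≤ e) ↔ range e = range f

namespace OrderedBratteliDiagram

attribute [instance] OrderedBratteliDiagram.finite_V OrderedBratteliDiagram.finite_E
  OrderedBratteliDiagram.order

/-- There is a finite path from the vertex `u` of level `n` to the vertex `v` of level `N`. -/
inductive Connected (D : OrderedBratteliDiagram) {n : ℕ} (u : D.V n) : (N : ℕ) → D.V N → Prop
  | refl : Connected D u n u
  | step {N : ℕ} (e : D.E N) : Connected D u N (D.source e) → Connected D u (N + 1) (D.range e)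

/-- Simple (or primitive) diagrams. -/
def IsSimple (D : OrderedBratteliDiagram) : Prop :=
  ∀ n, 1 ≤ n → ∃ N, n < N ∧ ∀ (u : D.V n) (v : D.V N), D.Connected u N v

/-- The space of infinite paths. -/
@[ext]
structure PathSpace (D : OrderedBratteliDiagram) where
  edge : ∀ n, D.E n
  range_edge : ∀ n, D.range (edge n) = D.source (edge (n + 1))

/-- The topology generated by the cylinder sets, that is, induced by the product of the discrete
topologies. -/
instance instTopologicalSpacePathSpace (D : OrderedBratteliDiagram) :
    TopologicalSpace D.PathSpace :=
  TopologicalSpace.induced PathSpace.edge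
    (@Pi.topologicalSpace ℕ D.E (fun _ => (⊥ : TopologicalSpace _)))

/-- Properly ordered: exactly one path consists of maximal edges and exactly one path consists of
minimal edges. -/
def IsProperlyOrdered (D : OrderedBratteliDiagram) : Prop :=
  (∃! x : D.PathSpace, ∀ n, IsMax (x.edge n)) ∧ (∃! x : D.PathSpace, ∀ n, IsMin (x.edge n))

/-- The defining property of the Vershik map. A path of maximal edges goes to the path of
minimal edges. If `n` is the first level at which the edge of `x` is not maximal, then this edge is
replaced by its successor, the earlier edges by minimal ones, and the later edges are kept. -/
def IsVershikMap (D : OrderedBratteliDiagram) (f : D.PathSpace → D.PathSpace) : Prop :=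
  (∀ x : D.PathSpace, (∀ n, IsMax (x.edge n)) → ∀ n, IsMin ((f x).edge n)) ∧
  ∀ (x : D.PathSpace) (n : ℕ), (∀ m < n, IsMax (x.edge m)) → ¬ IsMax (x.edge n) →
    x.edge n ⋖ (f x).edge n ∧ (∀ m < n, IsMin ((f x).edge m)) ∧ ∀ m, n < m → (f x).edge m = x.edge m

theorem exists_isMin_range (D : OrderedBratteliDiagram) {n : ℕ} (v : D.V (n + 1)) :
    ∃ e : D.E n, IsMin e ∧ D.range e = v := by
  obtain ⟨e, he⟩ := D.range_surjective n v
  obtain ⟨f, hfe, hf⟩ := Finite.exists_le_minimal (p := fun _ : D.E n => True) (trivial : (fun _ => True) e)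
  exact ⟨f, fun g hg => hf.2 trivial hg, he ▸ (D.comparable_iff f e).1 (Or.inl hfe)⟩

theorem exists_min_prefix (D : OrderedBratteliDiagram) (n : ℕ) (e : D.E n) :
    ∃ p : ∀ m, D.E m, p n = e ∧ (∀ m < n, IsMin (p m)) ∧
      ∀ m < n, D.range (p m) = D.source (p (m + 1)) := by
  classical
  induction n with
  | zero =>
    have hE : ∀ m, Nonempty (D.E m) := by
      intro m
      induction m with
      | zero => exact ⟨e⟩
      | succ m ih =>
        obtain ⟨f⟩ := ih
        exact ⟨(D.source_surjective _ (D.range f)).choose⟩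
    exact ⟨Function.update (fun m => (hE m).some) 0 e, by simp, by simp, by simp⟩
  | succ n ih =>
    obtain ⟨f, hf, hfe⟩ := D.exists_isMin_range (D.source e)
    obtain ⟨p, hp, hmin, hpath⟩ := ih f
    refine ⟨Function.update p (n + 1) e, by simp, fun m hm => ?_, fun m hm => ?_⟩
    · rw [Function.update_of_ne (by omega)]
      rcases Nat.lt_succ_iff_lt_or_eq.1 hm with h | rfl
      · exact hmin m h
      · exact hp ▸ hf
    · rw [Function.update_of_ne (by omega)]
      rcases Nat.lt_succ_iff_lt_or_eq.1 hm with h | rfl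
      · rw [Function.update_of_ne (by omega)]
        exact hpath m h
      · rw [Function.update_self, hp, hfe]

theorem eq_of_isMin (D : OrderedBratteliDiagram) {n : ℕ} {e f : D.E n} (he : IsMin e)
    (hf : IsMin f) (h : D.range e = D.range f) : e = f := by
  rcases (D.comparable_iff e f).2 h with h | h
  · exact le_antisymm h (hf h)
  · exact le_antisymm (he h) h

theorem eq_of_covBy (D : OrderedBratteliDiagram) {n : ℕ} {e f g : D.E n} (hf : e ⋖ f)
    (hg : e ⋖ g) : f = g := by
  have h1 := (D.comparable_iff e f).1 (Or.inl hf.le)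
  have h2 := (D.comparable_iff e g).1 (Or.inl hg.le)
  rcases (D.comparable_iff f g).2 (h1.symm.trans h2) with h | h
  · exact h.eq_or_lt.resolve_right fun h => hg.2 hf.lt h
  · exact (h.eq_or_lt.resolve_right fun h => hf.2 hg.lt h).symm

theorem exists_covBy (D : OrderedBratteliDiagram) {n : ℕ} {e : D.E n} (he : ¬ IsMax e) :
    ∃ f, e ⋖ f := by
  obtain ⟨g, hg⟩ := not_isMax_iff.1 he
  obtain ⟨f, -, hf⟩ := Finite.exists_le_minimal (p := fun f : D.E n => e < f) hg
  exact ⟨f, hf.1, fun k hek hkf => (hf.2 hek hkf.le).not_gt hkf⟩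

theorem existsUnique_isVershikMap (D : OrderedBratteliDiagram) (hD : D.IsProperlyOrdered) :
    ∃! f, D.IsVershikMap f := by
  classical
  obtain ⟨-, xmin, hmin, hunique⟩ := hD
  have key : ∀ (x : D.PathSpace), ∃ y : D.PathSpace,
      ((∀ n, IsMax (x.edge n)) → ∀ n, IsMin (y.edge n)) ∧
      ∀ n : ℕ, (∀ m < n, IsMax (x.edge m)) → ¬ IsMax (x.edge n) →
        x.edge n ⋖ y.edge n ∧ (∀ m < n, IsMin (y.edge m)) ∧ ∀ m, n < m → y.edge m = x.edge m := by
    intro x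
    by_cases hx : ∀ n, IsMax (x.edge n)
    · exact ⟨xmin, fun _ => hmin, fun n _ h => absurd (hx n) h⟩
    · have hx' := not_forall.1 hx
      have hn := Nat.find_spec hx'
      have hlt : ∀ m < Nat.find hx', IsMax (x.edge m) := fun m hm => not_not.1 (Nat.find_min hx' hm)
      generalize Nat.find hx' = n at hn hlt
      obtain ⟨e, he⟩ := D.exists_covBy hn
      have her := (D.comparable_iff _ _).1 (Or.inl he.le)
      obtain ⟨p, hp, hpmin, hpath⟩ := D.exists_min_prefix n e
      refine ⟨⟨fun m => if m ≤ n then p m else x.edge m, fun m => ?_⟩, fun h => absurd h hx, ?_⟩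
      · rcases lt_trichotomy m n with h | rfl | h
        · simp only [if_pos h.le, if_pos (show m + 1 ≤ n by omega)]
          exact hpath m h
        · simp only [le_refl, if_true, if_neg (show ¬ m + 1 ≤ m by omega)]
          rw [hp, ← her]
          exact x.2 m
        · simp only [if_neg (show ¬ m ≤ n by omega), if_neg (show ¬ m + 1 ≤ n by omega)]
          exact x.2 m
      · intro n' hlt' hn'
        have : n' = n := by
          rcases lt_trichotomy n' n with h | h | h
          · exact absurd (hlt n' h) hn'
          · exact h
          · exact absurd (hlt' n h) hn
        subst this
        refine ⟨by simpa [hp] using he, fun m hm => ?_, fun m hm => ?_⟩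
        · simpa [hm.le] using hpmin m hm
        · simp [not_le.2 hm]
  choose f hf1 hf2 using key
  refine ⟨f, ⟨hf1, hf2⟩, ?_⟩
  rintro g ⟨hg1, hg2⟩
  funext x
  by_cases hx : ∀ n, IsMax (x.edge n)
  · rw [hunique _ (hg1 x hx), hunique _ (hf1 x hx)]
  · have hx' := not_forall.1 hx
    have hn := Nat.find_spec hx'
    have hlt : ∀ m < Nat.find hx', IsMax (x.edge m) := fun m hm => not_not.1 (Nat.find_min hx' hm)
    generalize Nat.find hx' = n at hn hlt
    obtain ⟨hg3, hg4, hg5⟩ := hg2 x n hlt hn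
    obtain ⟨hf3, hf4, hf5⟩ := hf2 x n hlt hn
    have hback : ∀ j, j ≤ n → (g x).edge (n - j) = (f x).edge (n - j) := by
      intro j
      induction j with
      | zero => exact fun _ => D.eq_of_covBy hg3 hf3
      | succ j ih =>
        intro hj
        refine D.eq_of_isMin (hg4 _ (by omega)) (hf4 _ (by omega)) ?_
        rw [(g x).2, (f x).2, show n - (j + 1) + 1 = n - j by omega, ih (by omega)]
    refine PathSpace.ext (funext fun m => ?_)
    rcases le_or_gt m n with h | h
    · have := hback (n - m) (by omega)
      rwa [show n - (n - m) = m by omega] at this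
    · rw [hg5 m h, hf5 m h]

/-- The Vershik map of a properly ordered Bratteli diagram. -/
noncomputable def vershikMap (D : OrderedBratteliDiagram) (hD : D.IsProperlyOrdered) :
    D.PathSpace → D.PathSpace :=
  (D.existsUnique_isVershikMap hD).choose

theorem isVershikMap_vershikMap (D : OrderedBratteliDiagram) (hD : D.IsProperlyOrdered) :
    D.IsVershikMap (D.vershikMap hD) :=
  (D.existsUnique_isVershikMap hD).choose_spec.1

/-- `D` is a Bratteli-Vershik representation of `(X, T)`: it is simple and properly ordered, and
its Bratteli-Vershik system is topologically conjugate to `(X, T)`. -/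
def IsRepresentation (D : OrderedBratteliDiagram) {X : Type*} [TopologicalSpace X]
    (T : X ≃ₜ X) : Prop :=
  D.IsSimple ∧ ∃ hD : D.IsProperlyOrdered, ∃ φ : X ≃ₜ D.PathSpace,
    ∀ x, φ (T x) = D.vershikMap hD (φ x)

end OrderedBratteliDiagram

/-- A (minimal Cantor) system has finite topological rank if it has a Bratteli-Vershik
representation with a uniformly bounded number of vertices per level. -/
def HasFiniteTopologicalRank {X : Type*} [TopologicalSpace X] (T : X ≃ₜ X) : Prop :=
  ∃ (D : OrderedBratteliDiagram) (d : ℕ), D.IsRepresentation T ∧ ∀ n, Nat.card (D.V n) ≤ d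

/-! ## Clopen sets and locally constant functions -/

section LocallyConstant

variable {Z : Type*} [TopologicalSpace Z]

/-! Both properties are equivalent to a third one: there are arbitrarily small clopen sets with a
bounded number of return words. The return word of a point of a clopen set `U` is what is read along
its orbit until the next visit to `U`.

From rank to `K`: let `U N` consist of the points whose first `N` edges are minimal. Until those
edges are all maximal, the Vershik map acts on them without looking at the later ones, and when they
are all maximal the next point is in `U N`. So, once the first `N` edges determine the coordinate at
the origin, the return word depends only on the vertex at level `N`, and there are at most `d`
return words. The sets shrink to a non-periodic point, hence the words become arbitrarily long
(`exists_retTime_ge`). Return words to a clopen set are always recognizable, because cutting an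
orbit at its visits to `U` is canonical (`recognizableSet_returnWord`).

From `K` to rank: let `K = k` and let an open set be given. Take a recognizable set of at most `k`
words, so long that each contains an occurrence of a fixed central block whose cylinder lies in the
open set. Mark one such occurrence in every word. Recognizability makes the set of marked points
clopen, and a return word is determined by two consecutive words, so there are at most `k * k` of
them (`RecognizableSet.exists_isClopen`). Now choose nested clopen sets of this kind, each inside a
cylinder so fine that its points agree on a window that decides membership and return words at the
previous level. Points with the same return word then agree on a neighbourhood of the whole word
(`eq_of_returnWord_eq`), so return words alone label the towers consistently. The resulting
`NestedTowers` is read as an ordered Bratteli diagram: vertices are towers, edges are visits of a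
tower to the previous base, ordered by height. -/

theorem IsClopen.eventually_mem_iff {s : Set Z} (hs : IsClopen s) (x : Z) :
    ∀ᶠ y in 𝓝 x, (y ∈ s ↔ x ∈ s) := by
  by_cases hx : x ∈ s
  · filter_upwards [hs.isOpen.mem_nhds hx] with y hy using iff_of_true hy hx
  · filter_upwards [hs.compl.isOpen.mem_nhds hx] with y hy using iff_of_false hy hx

/-- The least index is decided by finitely many clopen conditions, namely those up to its value at
the given point. -/
theorem isLocallyConstant_sInf {P : ℕ → Set Z} (hP : ∀ n, IsClopen (P n))
    (hne : ∀ x, ∃ n, x ∈ P n) : IsLocallyConstant fun x => sInf {n | x ∈ P n} := by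
  rw [IsLocallyConstant.iff_eventually_eq]
  intro x
  have h : ∀ᶠ y in 𝓝 x, ∀ n ∈ Finset.range (sInf {n | x ∈ P n} + 1), (y ∈ P n ↔ x ∈ P n) :=
    (Finset.eventually_all _).2 fun n _ => (hP n).eventually_mem_iff x
  filter_upwards [h] with y hy
  have hx : x ∈ P (sInf {n | x ∈ P n}) := Nat.sInf_mem (s := {n | x ∈ P n}) (hne x)
  have hy' : y ∈ P (sInf {n | y ∈ P n}) := Nat.sInf_mem (s := {n | y ∈ P n}) (hne y)
  have h1 : sInf {n | y ∈ P n} ≤ sInf {n | x ∈ P n} :=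
    Nat.sInf_le ((hy _ (Finset.mem_range.2 (Nat.lt_succ_self _))).2 hx)
  exact le_antisymm h1 (Nat.sInf_le ((hy _ (Finset.mem_range.2 (Nat.lt_succ_of_le h1))).1 hy'))

/-- A locally constant function on a compact space factors through all but finitely many of a
decreasing sequence of closed relations that shrinks to the diagonal. -/
theorem IsLocallyConstant.exists_factor [CompactSpace Z] {α : Type*} {f : Z → α}
    (hf : IsLocallyConstant f) {r : ℕ → Z → Z → Prop}
    (hclosed : ∀ n, IsClosed {p : Z × Z | r n p.1 p.2})
    (hanti : ∀ n x y, r (n + 1) x y → r n x y) (hdiag : ∀ x y, (∀ n, r n x y) → x = y) :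
    ∃ N, ∀ n, N ≤ n → ∀ x y, r n x y → f x = f y := by
  have hmono : ∀ {m n}, m ≤ n → ∀ x y, r n x y → r m x y := by
    intro m n hmn x y h
    induction n, hmn using Nat.le_induction with
    | base => exact h
    | succ n _ ih => exact ih (hanti n x y h)
  have hfc : IsClosed {p : Z × Z | f p.1 ≠ f p.2} := by
    rw [← isOpen_compl_iff, isOpen_iff_mem_nhds]
    rintro ⟨x, y⟩ hxy
    have hxy' : f x = f y := not_not.1 hxy
    filter_upwards [(hf.eventually_eq x).prod_nhds (hf.eventually_eq y)] with p hp
    simp only [mem_compl_iff, mem_ofPred_eq, not_not]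
    rw [hp.1, hp.2, hxy']
  by_contra hcon
  push Not at hcon
  have hne : (⋂ n, ({p : Z × Z | r n p.1 p.2} ∩ {p | f p.1 ≠ f p.2})).Nonempty := by
    refine IsCompact.nonempty_iInter_of_sequence_nonempty_isCompact_isClosed _ ?_ ?_ ?_ ?_
    · exact fun n p hp => ⟨hanti n _ _ hp.1, hp.2⟩
    · intro n
      obtain ⟨m, hm, x, y, hxy, hne⟩ := hcon n
      exact ⟨(x, y), hmono hm x y hxy, hne⟩
    · exact ((hclosed 0).inter hfc).isCompact
    · exact fun n => (hclosed n).inter hfc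
  obtain ⟨⟨x, y⟩, hxy⟩ := hne
  rw [mem_iInter] at hxy
  exact (hxy 0).2 (congrArg f (hdiag x y fun n => (hxy n).1))

end LocallyConstant

/-! ## Return times -/

section ReturnTime

variable {Z : Type*} [TopologicalSpace Z]

theorem Homeomorph.zpow_add_apply (T : Z ≃ₜ Z) (a b : ℤ) (x : Z) :
    (T ^ (a + b)) x = (T ^ a) ((T ^ b) x) := by
  rw [zpow_add]; rfl

theorem Homeomorph.zpow_zero_apply (T : Z ≃ₜ Z) (x : Z) : (T ^ (0 : ℤ)) x = x := rfl

theorem Homeomorph.zpow_zpow_apply (T : Z ≃ₜ Z) {a b c : ℤ} (h : a + b = c) (x : Z) :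
    (T ^ a) ((T ^ b) x) = (T ^ c) x := by
  rw [← h, T.zpow_add_apply]

theorem Homeomorph.zpow_neg_self_apply (T : Z ≃ₜ Z) (a : ℤ) (x : Z) :
    (T ^ a) ((T ^ (-a)) x) = x := by
  rw [T.zpow_zpow_apply (add_neg_cancel a), T.zpow_zero_apply]

/-- Every point visits `U` in the future and in the past. -/
structure IsBirecurrent (T : Z ≃ₜ Z) (U : Set Z) : Prop where
  future : ∀ x, ∃ n : ℕ, 0 < n ∧ (T ^ (n : ℤ)) x ∈ U
  past : ∀ x, ∃ n : ℕ, 0 < n ∧ (T ^ (-(n : ℤ))) x ∈ U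

/-- Compactness turns density of orbits into a uniform bound on the entry time. -/
theorem IsMinimalHomeo.exists_bound [CompactSpace Z] {T : Z ≃ₜ Z} (hT : IsMinimalHomeo T)
    {U : Set Z} (hU : IsOpen U) (hne : U.Nonempty) :
    ∃ M : ℕ, ∀ x, ∃ i : ℕ, i < M ∧ (T ^ (i : ℤ)) x ∈ U := by
  have hcover : (univ : Set Z) ⊆ ⋃ n : ℤ, (T ^ n) ⁻¹' U := by
    intro x _
    obtain ⟨_, hy, n, rfl⟩ := (hT x).inter_open_nonempty U hU hne
    exact mem_iUnion.2 ⟨n, hy⟩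
  obtain ⟨t, ht⟩ := isCompact_univ.elim_finite_subcover _
    (fun n : ℤ => hU.preimage (T ^ n).continuous) hcover
  obtain ⟨L, hL⟩ : ∃ L : ℕ, ∀ n ∈ t, n.natAbs ≤ L :=
    ⟨t.sup Int.natAbs, fun n hn => Finset.le_sup (f := Int.natAbs) hn⟩
  -- The finite subcover gives times in `[-L, L]`; applying it to `T ^ L x` moves them to `[0, 2 *
  -- L]`.
  refine ⟨2 * L + 1, fun x => ?_⟩
  have hx := ht (mem_univ ((T ^ (L : ℤ)) x))
  simp only [mem_iUnion] at hx
  obtain ⟨n, hn, hx⟩ := hx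
  have := hL n hn
  refine ⟨(n + L).toNat, by omega, ?_⟩
  rw [Int.toNat_of_nonneg (by omega), T.zpow_add_apply]
  exact hx

theorem IsMinimalHomeo.isBirecurrent [CompactSpace Z] {T : Z ≃ₜ Z} (hT : IsMinimalHomeo T)
    {U : Set Z} (hU : IsOpen U) (hne : U.Nonempty) : IsBirecurrent T U := by
  obtain ⟨M, hM⟩ := hT.exists_bound hU hne
  constructor
  · intro x
    obtain ⟨i, -, hi⟩ := hM ((T ^ (1 : ℤ)) x)
    rw [T.zpow_zpow_apply rfl] at hi
    exact ⟨i + 1, by omega, by exact_mod_cast hi⟩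
  · intro x
    obtain ⟨i, hi, hx⟩ := hM ((T ^ (-(M : ℤ))) x)
    rw [T.zpow_zpow_apply rfl] at hx
    refine ⟨M - i, by omega, ?_⟩
    rw [Nat.cast_sub hi.le]
    convert hx using 3
    ring

/-- The time of the first return to `U` in the (strict) future. -/
noncomputable def retTime (T : Z ≃ₜ Z) (U : Set Z) (x : Z) : ℕ :=
  sInf {n : ℕ | 0 < n ∧ (T ^ (n : ℤ)) x ∈ U}

/-- The time since the last visit to `U`. -/
noncomputable def backTime (T : Z ≃ₜ Z) (U : Set Z) (x : Z) : ℕ :=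
  sInf {n : ℕ | (T ^ (-(n : ℤ))) x ∈ U}

/-- The point of the last visit to `U`. -/
noncomputable def lastVisit (T : Z ≃ₜ Z) (U : Set Z) (x : Z) : Z :=
  (T ^ (-(backTime T U x : ℤ))) x

theorem zpow_notMem_of_lt_retTime {T : Z ≃ₜ Z} {U : Set Z} {x : Z} {n : ℕ} (h0 : 0 < n)
    (hn : n < retTime T U x) : (T ^ (n : ℤ)) x ∉ U :=
  fun h => Nat.notMem_of_lt_sInf hn ⟨h0, h⟩

theorem retTime_le {T : Z ≃ₜ Z} {U : Set Z} {x : Z} {n : ℕ} (h0 : 0 < n)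
    (hn : (T ^ (n : ℤ)) x ∈ U) : retTime T U x ≤ n :=
  Nat.sInf_le ⟨h0, hn⟩

theorem backTime_le {T : Z ≃ₜ Z} {U : Set Z} {x : Z} {n : ℕ}
    (hn : (T ^ (-(n : ℤ))) x ∈ U) : backTime T U x ≤ n :=
  Nat.sInf_le hn

theorem backTime_eq_zero {T : Z ≃ₜ Z} {U : Set Z} {x : Z} (hx : x ∈ U) : backTime T U x = 0 :=
  Nat.le_zero.1 (backTime_le (by simpa using hx))

theorem lastVisit_eq_self {T : Z ≃ₜ Z} {U : Set Z} {x : Z} (hx : x ∈ U) :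
    lastVisit T U x = x := by
  rw [lastVisit, backTime_eq_zero hx]; rfl

theorem zpow_backTime_lastVisit (T : Z ≃ₜ Z) (U : Set Z) (x : Z) :
    (T ^ (backTime T U x : ℤ)) (lastVisit T U x) = x :=
  T.zpow_neg_self_apply _ x

namespace IsBirecurrent

variable {T : Z ≃ₜ Z} {U : Set Z}

theorem retTime_pos (h : IsBirecurrent T U) (x : Z) : 0 < retTime T U x :=
  (Nat.sInf_mem (s := {n : ℕ | 0 < n ∧ (T ^ (n : ℤ)) x ∈ U}) (h.future x)).1

theorem zpow_retTime_mem (h : IsBirecurrent T U) (x : Z) :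
    (T ^ (retTime T U x : ℤ)) x ∈ U :=
  (Nat.sInf_mem (s := {n : ℕ | 0 < n ∧ (T ^ (n : ℤ)) x ∈ U}) (h.future x)).2

theorem retTime_eq (h : IsBirecurrent T U) {x : Z} {n : ℕ} (h0 : 0 < n)
    (hn : (T ^ (n : ℤ)) x ∈ U) (hlt : ∀ m : ℕ, 0 < m → m < n → (T ^ (m : ℤ)) x ∉ U) :
    retTime T U x = n := by
  refine le_antisymm (retTime_le h0 hn) (not_lt.1 fun hl => ?_)
  exact hlt _ (h.retTime_pos x) hl (h.zpow_retTime_mem x)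

theorem lastVisit_mem (h : IsBirecurrent T U) (x : Z) : lastVisit T U x ∈ U :=
  Nat.sInf_mem (s := {n : ℕ | (T ^ (-(n : ℤ))) x ∈ U})
    (let ⟨n, _, hn⟩ := h.past x; ⟨n, hn⟩)

/-- Otherwise the first return after the last visit would be a visit at least as recent as the
present, contradicting the choice of the last one. Thus every point lies in the tower above its last
visit. -/
theorem backTime_lt_retTime (h : IsBirecurrent T U) (x : Z) :
    backTime T U x < retTime T U (lastVisit T U x) := by
  by_contra hcon
  rw [not_lt] at hcon
  have h1 := h.zpow_retTime_mem (lastVisit T U x)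
  have h2 := h.retTime_pos (lastVisit T U x)
  rw [lastVisit, T.zpow_zpow_apply rfl, ← lastVisit] at h1
  have h3 : backTime T U x ≤ backTime T U x - retTime T U (lastVisit T U x) := by
    refine backTime_le ?_
    rw [Nat.cast_sub hcon]
    convert h1 using 3
    ring
  omega

theorem backTime_zpow (h : IsBirecurrent T U) {x : Z} (hx : x ∈ U) {p : ℕ}
    (hp : p < retTime T U x) : backTime T U ((T ^ (p : ℤ)) x) = p := by
  have hle : backTime T U ((T ^ (p : ℤ)) x) ≤ p :=
    backTime_le (by rw [T.zpow_zpow_apply (neg_add_cancel _)]; exact hx)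
  by_contra hne
  have hm := h.lastVisit_mem ((T ^ (p : ℤ)) x)
  rw [lastVisit, T.zpow_zpow_apply rfl] at hm
  refine zpow_notMem_of_lt_retTime (T := T) (U := U) (x := x)
    (n := p - backTime T U ((T ^ (p : ℤ)) x)) (by omega) (by omega) ?_
  rw [Nat.cast_sub hle]
  convert hm using 3
  ring

theorem lastVisit_zpow (h : IsBirecurrent T U) {x : Z} (hx : x ∈ U) {p : ℕ}
    (hp : p < retTime T U x) : lastVisit T U ((T ^ (p : ℤ)) x) = x := by
  rw [lastVisit, h.backTime_zpow hx hp, T.zpow_zpow_apply (neg_add_cancel _), T.zpow_zero_apply]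

theorem backTime_apply (h : IsBirecurrent T U) {x : Z} (hx : T x ∉ U) :
    backTime T U (T x) = backTime T U x + 1 := by
  have key : ∀ n : ℕ, (T ^ (-((n + 1 : ℕ) : ℤ))) (T x) = (T ^ (-(n : ℤ))) x := fun n => by
    have : (T ^ (1 : ℤ)) x = T x := by rw [zpow_one]
    rw [← this, T.zpow_zpow_apply]
    push_cast; ring
  have hmem : ∀ n : ℕ, (T ^ (-(n : ℤ))) (T x) ∈ U → n ≠ 0 := by
    rintro _ h rfl
    exact hx h
  apply le_antisymm
  · refine backTime_le ?_
    rw [key]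
    exact h.lastVisit_mem x
  · have h1 : lastVisit T U (T x) ∈ U := h.lastVisit_mem _
    obtain ⟨n, hn⟩ := Nat.exists_eq_succ_of_ne_zero (hmem _ h1)
    rw [lastVisit, hn, Nat.succ_eq_add_one, key] at h1
    rw [hn]
    exact Nat.succ_le_succ (backTime_le h1)

theorem lastVisit_apply (h : IsBirecurrent T U) {x : Z} (hx : T x ∉ U) :
    lastVisit T U (T x) = lastVisit T U x := by
  have : (T ^ (1 : ℤ)) x = T x := by rw [zpow_one]
  rw [lastVisit, h.backTime_apply hx, lastVisit, ← this, T.zpow_zpow_apply]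
  push_cast; ring

theorem isLocallyConstant_retTime (h : IsBirecurrent T U) (hU : IsClopen U) :
    IsLocallyConstant (retTime T U) := by
  refine isLocallyConstant_sInf (P := fun n : ℕ => {x | 0 < n ∧ (T ^ (n : ℤ)) x ∈ U})
    (fun n => ?_) h.future
  by_cases hn : 0 < n
  · simp only [hn, true_and]
    exact hU.preimage (T ^ (n : ℤ)).continuous
  · simp only [hn, false_and]
    exact isClopen_empty

theorem isLocallyConstant_backTime (h : IsBirecurrent T U) (hU : IsClopen U) :
    IsLocallyConstant (backTime T U) :=
  isLocallyConstant_sInf (P := fun n : ℕ => {x | (T ^ (-(n : ℤ))) x ∈ U})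
    (fun n => hU.preimage (T ^ (-(n : ℤ))).continuous) fun x => ⟨_, h.lastVisit_mem x⟩

theorem continuous_lastVisit (h : IsBirecurrent T U) (hU : IsClopen U) :
    Continuous (lastVisit T U) := by
  rw [continuous_iff_continuousAt]
  intro x
  have h1 := (h.isLocallyConstant_backTime hU).eventually_eq x
  refine ((T ^ (-(backTime T U x : ℤ))).continuous.continuousAt).congr ?_
  filter_upwards [h1] with y hy
  rw [lastVisit, hy]

/-- The first return map, a permutation of `U`. -/
noncomputable def returnEquiv (h : IsBirecurrent T U) : Equiv.Perm U :=
  Equiv.ofBijective (fun x => ⟨(T ^ (retTime T U x : ℤ)) x, h.zpow_retTime_mem x⟩) <| by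
    constructor
    · have key : ∀ x y : U, retTime T U x ≤ retTime T U y →
          (T ^ (retTime T U x : ℤ)) (x : Z) = (T ^ (retTime T U y : ℤ)) (y : Z) → x = y := by
        intro x y hle hxy
        have hx : (x : Z) = (T ^ ((retTime T U y - retTime T U x : ℕ) : ℤ)) (y : Z) := by
          have := congrArg (T ^ (-(retTime T U x : ℤ))) hxy
          rw [T.zpow_zpow_apply (neg_add_cancel _), T.zpow_zero_apply, T.zpow_zpow_apply rfl] at this
          refine this.trans ?_
          rw [Nat.cast_sub hle]
          congr 2
          ring
        -- If the return times differed, `x` would be a visit of the orbit of `y` to `U` before the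
        -- first return of `y`.
        rcases Nat.eq_zero_or_pos (retTime T U y - retTime T U x) with h0 | h0
        · rw [h0] at hx
          exact Subtype.ext hx
        · have hpos := h.retTime_pos (x : Z)
          exact absurd (hx ▸ x.2) (zpow_notMem_of_lt_retTime h0 (by omega))
      intro x y hxy
      have hxy' := congrArg Subtype.val hxy
      rcases le_total (retTime T U x) (retTime T U y) with hle | hle
      · exact key x y hle hxy'
      · exact (key y x hle hxy'.symm).symm
    · intro y
      -- The preimage of `y` is the last visit to `U` strictly before `y`.
      set z := (T ^ (-1 : ℤ)) (y : Z) with hz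
      have hy : (T ^ (1 : ℤ)) z = y := T.zpow_neg_self_apply 1 _
      have hzy : (T ^ ((backTime T U z + 1 : ℕ) : ℤ)) (lastVisit T U z) = y := by
        rw [← hy, Nat.cast_add, add_comm, Nat.cast_one, T.zpow_add_apply, zpow_backTime_lastVisit]
      refine ⟨⟨lastVisit T U z, h.lastVisit_mem z⟩, Subtype.ext ?_⟩
      have hr : retTime T U (lastVisit T U z) = backTime T U z + 1 :=
        le_antisymm (retTime_le (Nat.succ_pos _) (hzy ▸ y.2)) (h.backTime_lt_retTime z)
      simp only [hr]
      exact hzy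

theorem coe_returnEquiv (h : IsBirecurrent T U) (x : U) :
    (h.returnEquiv x : Z) = (T ^ (retTime T U x : ℤ)) (x : Z) := rfl

end IsBirecurrent

/-- A periodic orbit is finite, hence closed; being dense it would be the whole infinite space. -/
theorem IsMinimalHomeo.zpow_ne_self [T2Space Z] [Infinite Z] {T : Z ≃ₜ Z}
    (hT : IsMinimalHomeo T) {n : ℕ} (hn : 0 < n) (x : Z) : (T ^ (n : ℤ)) x ≠ x := by
  intro hx
  have hper : ∀ k : ℤ, (T ^ (n * k)) x = x := by
    intro k
    have h1 : ∀ k : ℤ, (T ^ (n * (k + 1))) x = (T ^ (n * k)) x := fun k => by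
      rw [mul_add, mul_one, T.zpow_add_apply, hx]
    induction k using Int.induction_on with
    | zero => simp
    | succ k ih => rw [h1, ih]
    | pred k ih =>
      rw [← h1, sub_add_cancel, ih]
  have hfin : (Set.range fun k : ℤ => (T ^ k) x).Finite := by
    refine ((Finset.range n).finite_toSet.image fun k : ℕ => (T ^ (k : ℤ)) x).subset ?_
    rintro _ ⟨k, rfl⟩
    have hn' : (n : ℤ) ≠ 0 := by omega
    have h0 := Int.emod_nonneg k hn'
    have h1 := Int.emod_lt_of_pos k (show (0 : ℤ) < n by omega)
    refine ⟨(k % n).toNat, ?_, ?_⟩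
    · simp only [Finset.coe_range, mem_Iio]
      omega
    · simp only [Int.toNat_of_nonneg h0]
      conv_rhs => rw [← Int.emod_add_mul_ediv k n, T.zpow_add_apply, hper]
  have huniv := (hT x).closure_eq
  rw [hfin.isClosed.closure_eq] at huniv
  exact infinite_univ (huniv ▸ hfin)

/-- The return times to a sequence of clopen sets that shrinks to a non-periodic point tend to
infinity. -/
theorem exists_retTime_ge [CompactSpace Z] [T2Space Z] {T : Z ≃ₜ Z} {U : ℕ → Set Z}
    (hU : ∀ n, IsClosed (U n)) (hanti : Antitone U) (hrec : ∀ n, IsBirecurrent T (U n)) {p : Z}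
    (hp : ∀ x, (∀ n, x ∈ U n) → x = p) (hper : ∀ n : ℕ, 0 < n → (T ^ (n : ℤ)) p ≠ p) (M : ℕ) :
    ∃ N, ∀ n, N ≤ n → ∀ x ∈ U n, M ≤ retTime T (U n) x := by
  -- If return time `i` occurred at infinitely many levels, a compactness limit would be a point `x`
  -- with `x` and `T ^ i x` in all the sets, so both equal to `p`.
  have key : ∀ i : ℕ, 0 < i → ∃ N, ∀ n, N ≤ n → ∀ x ∈ U n, (T ^ (i : ℤ)) x ∉ U n := by
    intro i hi
    by_contra hcon
    push Not at hcon
    have hne : (⋂ n, (U n ∩ (T ^ (i : ℤ)) ⁻¹' U n)).Nonempty := by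
      refine IsCompact.nonempty_iInter_of_sequence_nonempty_isCompact_isClosed _ ?_ ?_ ?_ ?_
      · exact fun n x hx => ⟨hanti n.le_succ hx.1, hanti n.le_succ hx.2⟩
      · intro n
        obtain ⟨m, hm, x, hx, hx'⟩ := hcon n
        exact ⟨x, hanti hm hx, hanti hm hx'⟩
      · exact ((hU 0).inter ((hU 0).preimage (T ^ (i : ℤ)).continuous)).isCompact
      · exact fun n => (hU n).inter ((hU n).preimage (T ^ (i : ℤ)).continuous)
    obtain ⟨x, hx⟩ := hne
    rw [mem_iInter] at hx
    have h1 := hp x fun n => (hx n).1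
    have h2 := hp _ fun n => (hx n).2
    rw [h1] at h2
    exact hper i hi h2
  choose N hN using fun i : ℕ => key (i + 1) i.succ_pos
  refine ⟨(Finset.range M).sup N, fun n hn x hx => ?_⟩
  by_contra hlt
  have hpos := (hrec n).retTime_pos x
  have hmem := (hrec n).zpow_retTime_mem x
  obtain ⟨i, hi⟩ := Nat.exists_eq_succ_of_ne_zero hpos.ne'
  rw [hi] at hmem
  exact hN i n ((Finset.le_sup (Finset.mem_range.2 (by omega))).trans hn) x hx hmem

end ReturnTime

/-! ## Morphisms acting on two-sided sequences -/

theorem shiftBy_zero {A : Type*} (x : ℤ → A) : shiftBy 0 x = x := by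
  funext n; simp [shiftBy]

theorem shiftBy_shiftBy {A : Type*} (k l : ℤ) (x : ℤ → A) :
    shiftBy k (shiftBy l x) = shiftBy (l + k) x := by
  funext n; simp only [shiftBy]; congr 1; ring

theorem continuous_shiftBy {A : Type*} [TopologicalSpace A] (k : ℤ) :
    Continuous (shiftBy k : (ℤ → A) → ℤ → A) := by
  unfold shiftBy; fun_prop

/-- Two-sided induction: the equivalence in the step serves both directions. -/
theorem eq_of_int_succ {α : Type*} {f g : ℤ → α} (h0 : f 0 = g 0)
    (hs : ∀ k, f k = g k ↔ f (k + 1) = g (k + 1)) : f = g := by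
  funext k
  induction k using Int.induction_on with
  | zero => exact h0
  | succ k ih => exact (hs _).1 ih
  | pred k ih => exact (hs _).2 (by rwa [sub_add_cancel])

namespace WordMorphism

variable {A B : Type*} (τ : WordMorphism A B)

theorem apply_eq {y : ℤ → A} {x : ℤ → B} (h : τ.IsImage y x) : τ.apply y = x :=
  (τ.existsUnique_isImage y).unique (τ.isImage_apply y) h

theorem cut_shiftBy (y : ℤ → A) (k j : ℤ) :
    τ.cut (shiftBy k y) j = τ.cut y (j + k) - τ.cut y k := by
  refine congrFun (eq_of_int_succ (f := τ.cut (shiftBy k y))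
    (g := fun j => τ.cut y (j + k) - τ.cut y k) (by simp [cut_zero]) fun j => ?_) j
  rw [cut_add_one, show j + 1 + k = j + k + 1 by ring, cut_add_one]
  simp only [shiftBy]
  omega

theorem apply_shiftBy (y : ℤ → A) (k : ℤ) :
    τ.apply (shiftBy k y) = shiftBy (τ.cut y k) (τ.apply y) := by
  refine τ.apply_eq fun l j hj => ?_
  simp only [shiftBy, cut_shiftBy] at hj ⊢
  rw [← τ.isImage_apply y (l + k) j hj]
  congr 1
  ring

theorem cut_one (y : ℤ → A) : τ.cut y 1 = (τ.word (y 0)).length := by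
  have := τ.cut_add_one y 0
  rwa [zero_add, cut_zero, zero_add] at this

theorem apply_of_lt (y : ℤ → A) (j : ℕ) (hj : j < (τ.word (y 0)).length) :
    τ.apply y j = (τ.word (y 0))[j] := by
  have := τ.isImage_apply y 0 j hj
  rwa [cut_zero, zero_add] at this

/-- The words `τ(y_0) τ(y_1)` start `τ(y)`. -/
theorem apply_of_lt_add (y : ℤ → A) (j : ℕ)
    (hj : j < (τ.word (y 0) ++ τ.word (y 1)).length) :
    τ.apply y j = (τ.word (y 0) ++ τ.word (y 1))[j] := by
  rcases lt_or_ge j (τ.word (y 0)).length with h | h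
  · rw [List.getElem_append_left h, τ.apply_of_lt y j h]
  · rw [List.length_append] at hj
    rw [List.getElem_append_right h, ← τ.isImage_apply y 1 _ (by omega), cut_one]
    congr 1
    omega

variable [TopologicalSpace A] [DiscreteTopology A]

theorem continuous_cut (k : ℤ) : Continuous fun y : ℤ → A => τ.cut y k := by
  have hc : ∀ i : ℤ, Continuous fun y : ℤ → A => ((τ.word (y i)).length : ℤ) := fun i =>
    (continuous_of_discreteTopology (f := fun a => ((τ.word a).length : ℤ))).comp
      (continuous_apply i)
  rcases k with n | n
  · exact continuous_finsetSum _ fun i _ => hc i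
  · exact (continuous_finsetSum _ fun i _ => hc _).neg

/-- The coordinate `i` of `τ(y)` depends only on a cut position `τ.cut y k` and the letter `y k`,
both locally constant in `y`. -/
theorem continuous_apply_morphism [TopologicalSpace B] :
    Continuous (τ.apply : (ℤ → A) → ℤ → B) := by
  refine continuous_pi fun i => continuous_iff_continuousAt.2 fun y => ?_
  obtain ⟨k, hk1, hk2⟩ := τ.exists_cut y i
  have h1 : ∀ᶠ y' in 𝓝 y, τ.cut y' k = τ.cut y k :=
    ((IsLocallyConstant.iff_continuous _).2 (τ.continuous_cut k)).eventually_eq y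
  have h2 : ∀ᶠ y' in 𝓝 y, y' k = y k :=
    ((IsLocallyConstant.iff_continuous _).2 (continuous_apply k)).eventually_eq y
  refine (continuousAt_const (y := τ.apply y i)).congr ?_
  rw [cut_add_one] at hk2
  filter_upwards [h1, h2] with y' hc hy
  have h3 := τ.isImage_apply y k (i - τ.cut y k).toNat (by omega)
  have h4 := τ.isImage_apply y' k (i - τ.cut y k).toNat (by rw [hy]; omega)
  rw [hc] at h4
  simp only [hy] at h4
  rw [← h3, Int.toNat_of_nonneg (by omega), add_sub_cancel] at h4
  exact h4.symm

end WordMorphism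

/-! ## Return words -/

namespace Subshift

variable {B : Type*} [TopologicalSpace B] (X : Subshift B)

instance [Finite B] : CompactSpace X.carrier :=
  isCompact_iff_compactSpace.1 X.isClosed.isCompact

theorem coe_shift_zpow (k : ℤ) (x : X.carrier) :
    ((X.shift ^ k) x : ℤ → B) = shiftBy k x := by
  refine congrFun (eq_of_int_succ (f := fun k : ℤ => ((X.shift ^ k) x : ℤ → B))
    (g := fun k => shiftBy k x) (shiftBy_zero _).symm fun k => ?_) k
  have h1 : ((X.shift ^ (k + 1)) x : ℤ → B) = shiftBy 1 ((X.shift ^ k) x : ℤ → B) := by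
    rw [add_comm, Homeomorph.zpow_add_apply, zpow_one]
    rfl
  have hinj : Function.Injective (shiftBy 1 : (ℤ → B) → ℤ → B) := (shiftHomeo B).injective
  rw [h1, ← shiftBy_shiftBy]
  exact hinj.eq_iff.symm

theorem shiftBy_mem {x : ℤ → B} (hx : x ∈ X.carrier) (k : ℤ) : shiftBy k x ∈ X.carrier :=
  X.coe_shift_zpow k ⟨x, hx⟩ ▸ ((X.shift ^ k) ⟨x, hx⟩).2

theorem shift_zpow_apply (k : ℤ) (x : X.carrier) (n : ℤ) :
    ((X.shift ^ k) x : ℤ → B) n = (x : ℤ → B) (n + k) := by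
  rw [coe_shift_zpow]; rfl

/-- The word read along the orbit of `x` until the first return to `U`. -/
noncomputable def returnWord (U : Set X.carrier) (x : X.carrier) : List B :=
  List.ofFn fun i : Fin (retTime X.shift U x) => (x : ℤ → B) i

theorem length_returnWord (U : Set X.carrier) (x : X.carrier) :
    (X.returnWord U x).length = retTime X.shift U x := List.length_ofFn

theorem getElem_returnWord (U : Set X.carrier) (x : X.carrier) (j : ℕ)
    (hj : j < (X.returnWord U x).length) : (X.returnWord U x)[j] = (x : ℤ → B) j := by
  simp [returnWord]

theorem returnWord_eq_iff (U : Set X.carrier) (x : X.carrier) (w : List B) :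
    X.returnWord U x = w ↔ retTime X.shift U x = w.length ∧
      ∀ (j : ℕ) (hj : j < w.length), (x : ℤ → B) j = w[j] := by
  constructor
  · rintro rfl
    exact ⟨(X.length_returnWord U x).symm, fun j hj => (X.getElem_returnWord U x j hj).symm⟩
  · rintro ⟨h1, h2⟩
    refine List.ext_getElem ((X.length_returnWord U x).trans h1) fun j h3 h4 => ?_
    rw [X.getElem_returnWord U x j h3, h2]

theorem returnWord_mem_language (U : Set X.carrier) (x : X.carrier) :
    X.returnWord U x ∈ X.language :=
  ⟨x, x.2, 0, fun i hi => by rw [zero_add, X.getElem_returnWord U x i hi]⟩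

theorem isLocallyConstant_returnWord [DiscreteTopology B] {U : Set X.carrier} (hU : IsClopen U)
    (hrec : IsBirecurrent X.shift U) : IsLocallyConstant (X.returnWord U) := by
  rw [IsLocallyConstant.iff_eventually_eq]
  intro x
  have h1 := (hrec.isLocallyConstant_retTime hU).eventually_eq x
  have h2 : ∀ᶠ y : X.carrier in 𝓝 x, ∀ j ∈ Finset.range (retTime X.shift U x),
      (y : ℤ → B) j = (x : ℤ → B) j :=
    (Finset.eventually_all _).2 fun j _ => ((IsLocallyConstant.iff_continuous _).2
      ((continuous_apply (j : ℤ)).comp continuous_subtype_val)).eventually_eq x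
  filter_upwards [h1, h2] with y hy hy'
  refine (X.returnWord_eq_iff U y _).2 ⟨hy.trans (X.length_returnWord U x).symm, fun j hj => ?_⟩
  rw [X.getElem_returnWord U x j hj]
  exact hy' j (Finset.mem_range.2 (X.length_returnWord U x ▸ hj))

/-- The return words to a clopen set are a recognizable set of words. -/
theorem recognizableSet_returnWord [Finite B] [DiscreteTopology B] {U : Set X.carrier}
    (hU : IsClopen U) (hrec : IsBirecurrent X.shift U) :
    X.RecognizableSet (X.returnWord U '' U) := by
  have hlc := X.isLocallyConstant_returnWord hU hrec
  have hfin : (X.returnWord U '' U).Finite := hlc.range_finite.subset (image_subset_range _ _)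
  have := hfin.to_subtype
  obtain ⟨m, ⟨e⟩⟩ := Finite.exists_equiv_fin (X.returnWord U '' U)
  let τ : WordMorphism (Fin m) B :=
    { word := fun a => (e.symm a : List B)
      word_ne_nil := fun a => by
        obtain ⟨x, -, hx⟩ := (e.symm a).2
        have := hrec.retTime_pos x
        rw [← X.length_returnWord, hx] at this
        exact List.length_pos_iff.1 this }
  have hτinj : Function.Injective τ.word := fun a b h => e.symm.injective (Subtype.ext h)
  have hτrange : Set.range τ.word = X.returnWord U '' U := by
    ext w
    constructor
    · rintro ⟨a, rfl⟩
      exact (e.symm a).2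
    · intro hw
      exact ⟨e ⟨w, hw⟩, by simp [τ]⟩
  -- A closed local condition. Requiring it of all shifts of `y` makes the cuts of `τ(y)` exactly
  -- its visits to `U`.
  let Q : Set (ℤ → Fin m) :=
    {y | ∃ x ∈ U, (x : ℤ → B) = τ.apply y ∧ X.returnWord U x = τ.word (y 0)}
  have hQ : IsClosed Q := by
    have hQeq : Q = ⋃ a : Fin m, ({y | y 0 = a} ∩
        τ.apply ⁻¹' (Subtype.val '' (U ∩ {x | X.returnWord U x = τ.word a}))) := by
      ext y
      simp only [Q, mem_iUnion, mem_inter_iff, mem_preimage, mem_image]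
      constructor
      · rintro ⟨x, hx, h1, h2⟩
        exact ⟨y 0, rfl, x, ⟨hx, h2⟩, h1⟩
      · rintro ⟨_, rfl, x, ⟨hx, h2⟩, h1⟩
        exact ⟨x, hx, h1, h2⟩
    rw [hQeq]
    refine isClosed_iUnion_of_finite fun a => IsClosed.inter ?_ ?_
    · exact isClosed_eq (continuous_apply 0) continuous_const
    · refine IsClosed.preimage τ.continuous_apply_morphism ?_
      exact (X.isClosed.isClosedEmbedding_subtypeVal.isClosedMap _
        (hU.isClosed.inter (hlc.isClosed_fiber _)))
  let Y : Subshift (Fin m) :=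
    { carrier := {y | ∀ k : ℤ, shiftBy k y ∈ Q}
      isClosed := by
        simp only [ofPred_forall]
        exact isClosed_iInter fun k => hQ.preimage (continuous_shiftBy k)
      image_shift := by
        ext y
        constructor
        · rintro ⟨y, hy, rfl⟩ k
          change shiftBy k (shiftBy 1 y) ∈ Q
          rw [shiftBy_shiftBy]
          exact hy _
        · intro hy
          refine ⟨(shiftHomeo _).symm y, fun k => ?_, (shiftHomeo _).apply_symm_apply y⟩
          change shiftBy k (shiftBy (-1) y) ∈ Q
          rw [shiftBy_shiftBy]
          exact hy _ }
  -- The coding of the points of `U`.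
  let code : U → ℤ → Fin m := fun z k =>
    e ⟨X.returnWord U ((hrec.returnEquiv ^ k) z : U), mem_image_of_mem _ (Subtype.coe_prop _)⟩
  have hword : ∀ z k, τ.word (code z k) = X.returnWord U ((hrec.returnEquiv ^ k) z : U) := by
    intro z k; simp [τ, code]
  have hcut : ∀ (z : U) (k : ℤ), ((hrec.returnEquiv ^ k) z : X.carrier) =
      (X.shift ^ (τ.cut (code z) k)) (z : X.carrier) := by
    intro z
    refine congrFun (eq_of_int_succ
      (f := fun k : ℤ => ((hrec.returnEquiv ^ k) z : X.carrier))
      (g := fun k => (X.shift ^ (τ.cut (code z) k)) (z : X.carrier)) ?_ fun k => ?_)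
    · simp [τ.cut_zero]
    · rw [add_comm k 1, zpow_add, zpow_one, Equiv.Perm.mul_apply, hrec.coe_returnEquiv,
        add_comm 1 k, τ.cut_add_one, hword, length_returnWord, add_comm,
        Homeomorph.zpow_add_apply]
      exact (Homeomorph.injective _).eq_iff.symm
  have happly : ∀ z : U, τ.apply (code z) = (z : X.carrier) := by
    intro z
    refine τ.apply_eq fun k j hj => ?_
    have h1 := hj
    simp only [hword] at h1 ⊢
    rw [getElem_returnWord, hcut, shift_zpow_apply, add_comm]
  have hshift : ∀ (z : U) (k : ℤ), shiftBy k (code z) = code ((hrec.returnEquiv ^ k) z) := by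
    intro z k
    funext j
    simp only [shiftBy, code]
    rw [zpow_add, Equiv.Perm.mul_apply]
  have hcodeY : ∀ z, code z ∈ Y.carrier := by
    intro z k
    rw [hshift]
    exact ⟨_, Subtype.coe_prop _, (happly _).symm, (hword _ 0).symm⟩
  -- The points of `U` at consecutive cuts are consecutive returns, so they form an orbit of the
  -- return map and `y` codes its starting point.
  have hYcode : ∀ y ∈ Y.carrier, ∃ z, y = code z := by
    intro y hy
    choose x hxU hx1 hx2 using hy
    let z : ℤ → U := fun k => ⟨x k, hxU k⟩
    have hnext : ∀ k, z (k + 1) = hrec.returnEquiv (z k) := by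
      intro k
      refine Subtype.ext (Subtype.ext ?_)
      change (x (k + 1) : ℤ → B) = _
      rw [hrec.coe_returnEquiv, coe_shift_zpow]
      change _ = shiftBy _ (x k : ℤ → B)
      rw [hx1, hx1, ← length_returnWord, hx2 k, τ.apply_shiftBy, τ.apply_shiftBy,
        shiftBy_shiftBy, τ.cut_add_one]
      simp [shiftBy]
    have hz : z = fun k => (hrec.returnEquiv ^ k) (z 0) := by
      refine eq_of_int_succ (by simp) fun k => ?_
      rw [hnext, add_comm k 1, zpow_add, zpow_one, Equiv.Perm.mul_apply]
      exact hrec.returnEquiv.injective.eq_iff.symm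
    refine ⟨z 0, funext fun k => hτinj ?_⟩
    have h1 : (z k : X.carrier) = x k := rfl
    rw [hword, ← congrFun hz k, h1, hx2]
    simp [shiftBy]
  refine ⟨m, Y, τ, hτrange, ?_, ?_⟩
  · ext x
    simp only [mem_iUnion, mem_image]
    constructor
    · intro hx
      refine ⟨backTime X.shift U ⟨x, hx⟩, code ⟨_, hrec.lastVisit_mem ⟨x, hx⟩⟩, hcodeY _, ?_⟩
      rw [happly, ← coe_shift_zpow, zpow_backTime_lastVisit]
    · rintro ⟨k, y, hy, rfl⟩
      obtain ⟨z, rfl⟩ := hYcode y hy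
      rw [happly]
      exact X.shiftBy_mem z.1.2 k
  -- A centered representation is forced: `k` is the time since the last visit to `U`, and `y` codes
  -- that visit.
  · have key : ∀ (x : ℤ → B) (k : ℤ) (y : ℤ → Fin m), τ.IsCenteredRepr Y.carrier x k y →
        ∃ hx : x ∈ X.carrier, k = backTime X.shift U ⟨x, hx⟩ ∧
          y = code ⟨_, hrec.lastVisit_mem ⟨x, hx⟩⟩ := by
      rintro x k y ⟨hy, hk0, hk, rfl⟩
      obtain ⟨z, rfl⟩ := hYcode y hy
      lift k to ℕ using hk0
      have hxz : shiftBy k (τ.apply (code z)) = ((X.shift ^ (k : ℤ)) (z : X.carrier) : ℤ → B) := by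
        rw [happly, coe_shift_zpow]
      have hk' : k < retTime X.shift U z := by
        rw [hword, length_returnWord] at hk
        exact_mod_cast hk
      have hx : shiftBy k (τ.apply (code z)) ∈ X.carrier := hxz ▸ Subtype.coe_prop _
      have hxe : (⟨_, hx⟩ : X.carrier) = (X.shift ^ (k : ℤ)) (z : X.carrier) := Subtype.ext hxz
      refine ⟨hx, ?_, ?_⟩
      · rw [hxe, hrec.backTime_zpow z.2 hk']
      · congr 1
        refine Subtype.ext ?_
        rw [hxe]
        exact (hrec.lastVisit_zpow z.2 hk').symm
    intro x k k' y y' h h'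
    obtain ⟨hx, h1, h2⟩ := key x k y h
    obtain ⟨_, h3, h4⟩ := key x k' y' h'
    exact ⟨h1.trans h3.symm, h2.trans h4.symm⟩

end Subshift

/-! ## From recognizable sets of words to clopen sets with few return words -/

namespace Subshift

variable {B : Type*} [TopologicalSpace B] {X : Subshift B}

/-- If every word of a recognizable set has a marked position that lies in `C`, then the marked
positions form a clopen subset of `C`, and its return words are determined by pairs of words. -/
theorem RecognizableSet.exists_isClopen [Finite B] [DiscreteTopology B] {W : Set (List B)}
    (hW : X.RecognizableSet W) (hne : X.carrier.Nonempty) (hmin : IsMinimalHomeo X.shift)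
    {C : Set X.carrier} (I : List B → ℕ) (hI : ∀ w ∈ W, I w < w.length)
    (hIC : ∀ w ∈ W, ∀ x : X.carrier, (∀ (j : ℕ) (hj : j < w.length), (x : ℤ → B) j = w[j]) →
      (X.shift ^ (I w : ℤ)) x ∈ C) :
    ∃ U : Set X.carrier, IsClopen U ∧ U.Nonempty ∧ U ⊆ C ∧
      (X.returnWord U '' U).encard ≤ W.encard * W.encard := by
  obtain ⟨m, Y, τ, rfl, hX, hτ⟩ := hW
  have hI' : ∀ a, I (τ.word a) < (τ.word a).length := fun a => hI _ (mem_range_self a)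
  have hYX : ∀ y ∈ Y.carrier, ∀ k : ℤ, shiftBy k (τ.apply y) ∈ X.carrier := by
    intro y hy k
    rw [hX]
    exact mem_iUnion.2 ⟨k, y, hy, rfl⟩
  have hrepr : ∀ x ∈ X.carrier, ∃ y ∈ Y.carrier, ∃ j : ℕ, j < (τ.word (y 0)).length ∧
      x = shiftBy j (τ.apply y) := by
    intro x hx
    rw [hX] at hx
    obtain ⟨k, y, hy, rfl⟩ := mem_iUnion.1 hx
    obtain ⟨i, hi1, hi2⟩ := τ.exists_cut y k
    rw [τ.cut_add_one] at hi2
    refine ⟨shiftBy i y, Y.shiftBy_mem hy i, (k - τ.cut y i).toNat, ?_, ?_⟩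
    · simp only [shiftBy, zero_add]
      omega
    · rw [Int.toNat_of_nonneg (by omega), τ.apply_shiftBy, shiftBy_shiftBy, add_sub_cancel]
  have huniq : ∀ y ∈ Y.carrier, ∀ y' ∈ Y.carrier, ∀ j j' : ℕ, j < (τ.word (y 0)).length →
      j' < (τ.word (y' 0)).length → shiftBy j (τ.apply y) = shiftBy j' (τ.apply y') →
      j = j' ∧ y = y' := by
    intro y hy y' hy' j j' hj hj' h
    have := hτ _ j j' y y' ⟨hy, by omega, by omega, rfl⟩ ⟨hy', by omega, by omega, h⟩
    exact ⟨by exact_mod_cast this.1, this.2⟩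
  -- The points at position `j` inside an occurrence of the word of the letter `a`. These sets are
  -- compact images, hence closed, and those with `j` inside the word cover `X`.
  let F : Fin m → ℕ → Set X.carrier := fun a j =>
    {x | ∃ y ∈ Y.carrier, y 0 = a ∧ (x : ℤ → B) = shiftBy j (τ.apply y)}
  have hF : ∀ a j, IsClosed (F a j) := by
    intro a j
    have h1 : IsClosed {y : ℤ → Fin m | y 0 = a} :=
      isClosed_eq (continuous_apply 0) continuous_const
    have h2 : IsCompact ((fun y => shiftBy j (τ.apply y)) '' (Y.carrier ∩ {y | y 0 = a})) :=
      (Y.isClosed.inter h1).isCompact.image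
        ((continuous_shiftBy (j : ℤ)).comp τ.continuous_apply_morphism)
    convert h2.isClosed.preimage continuous_subtype_val using 1
    ext x
    constructor
    · rintro ⟨y, hy, h0, hxy⟩
      exact ⟨y, ⟨hy, h0⟩, hxy.symm⟩
    · rintro ⟨y, ⟨hy, h0⟩, hxy⟩
      exact ⟨y, hy, h0, hxy.symm⟩
  let U : Set X.carrier :=
    {x | ∃ y ∈ Y.carrier, (x : ℤ → B) = shiftBy (I (τ.word (y 0))) (τ.apply y)}
  have hUclosed : IsClosed U := by
    have : U = ⋃ a, F a (I (τ.word a)) := by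
      ext x
      simp only [U, F, mem_iUnion]
      constructor
      · rintro ⟨y, hy, hx⟩
        exact ⟨y 0, y, hy, rfl, hx⟩
      · rintro ⟨_, y, hy, rfl, hx⟩
        exact ⟨y, hy, hx⟩
    rw [this]
    exact isClosed_iUnion_of_finite fun a => hF _ _
  -- By recognizability a point at an unmarked position is not also at a marked one, so the
  -- complement is a finite union of closed pieces.
  have hUopen : IsOpen U := by
    have : Uᶜ = ⋃ (a : Fin m) (j : Fin (τ.word a).length) (_ : (j : ℕ) ≠ I (τ.word a)),
        F a j := by
      ext x
      simp only [U, F, mem_iUnion, mem_compl_iff]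
      constructor
      · intro hx
        obtain ⟨y, hy, j, hj, hxy⟩ := hrepr x x.2
        refine ⟨y 0, ⟨j, hj⟩, fun h => hx ⟨y, hy, ?_⟩, y, hy, rfl, hxy⟩
        rw [← h]
        exact hxy
      · rintro ⟨_, j, hj, y, hy, rfl, hx⟩ ⟨y', hy', hx'⟩
        obtain ⟨h1, rfl⟩ := huniq y hy y' hy' j _ j.2 (hI' _) (hx.symm.trans hx')
        exact hj h1
    rw [← isClosed_compl_iff, this]
    exact isClosed_iUnion_of_finite fun a => isClosed_iUnion_of_finite fun j =>
      isClosed_iUnion_of_finite fun _ => hF _ _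
  have hUne : U.Nonempty := by
    obtain ⟨x, hx⟩ := hne
    obtain ⟨y, hy, -⟩ := hrepr x hx
    exact ⟨⟨_, hYX y hy _⟩, y, hy, rfl⟩
  have hrec := hmin.isBirecurrent hUopen hUne
  refine ⟨U, ⟨hUclosed, hUopen⟩, hUne, ?_, ?_⟩
  · rintro x ⟨y, hy, hx⟩
    have h1 : x = (X.shift ^ (I (τ.word (y 0)) : ℤ)) ⟨τ.apply y, shiftBy_zero (τ.apply y) ▸
        hYX y hy 0⟩ := Subtype.ext (by rw [coe_shift_zpow]; exact hx)
    rw [h1]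
    exact hIC _ (mem_range_self _) _ fun j hj => τ.apply_of_lt y j hj
  -- The segment of the concatenation of two words between the mark of the first and the mark of the
  -- second.
  · let g : List B × List B → List B := fun p =>
      ((p.1 ++ p.2).drop (I p.1)).take (p.1.length - I p.1 + I p.2)
    have hsub : X.returnWord U '' U ⊆ g '' (Set.range τ.word ×ˢ Set.range τ.word) := by
      rintro _ ⟨x, ⟨y, hy, hx⟩, rfl⟩
      refine ⟨(τ.word (y 0), τ.word (y 1)), ⟨mem_range_self _, mem_range_self _⟩, Eq.symm ?_⟩
      have h0 := hI' (y 0)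
      have h1 := hI' (y 1)
      have hy1 := Y.shiftBy_mem hy 1
      have hy10 : shiftBy 1 y 0 = y 1 := by simp [shiftBy]
      have hx1 : ∀ j : ℕ, shiftBy j (τ.apply (shiftBy 1 y)) =
          shiftBy ((τ.word (y 0)).length + j) (τ.apply y) := fun j => by
        rw [τ.apply_shiftBy, τ.cut_one, shiftBy_shiftBy]
      have hxn : ∀ n : ℕ, ((X.shift ^ (n : ℤ)) x : ℤ → B) =
          shiftBy (I (τ.word (y 0)) + n) (τ.apply y) := fun n => by
        rw [coe_shift_zpow, hx, shiftBy_shiftBy]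
      have hret : retTime X.shift U x =
          (τ.word (y 0)).length - I (τ.word (y 0)) + I (τ.word (y 1)) := by
        refine hrec.retTime_eq (by omega) ⟨_, hy1, ?_⟩ ?_
        · rw [hxn, hy10, hx1]
          congr 1
          omega
        -- Strictly between two consecutive marks the position lies either after the mark in the
        -- first word or before the mark in the second; uniqueness of the representation excludes a
        -- further mark.
        · rintro n hn0 hn ⟨y', hy', hxy'⟩
          rw [hxn] at hxy'
          rcases lt_or_ge (I (τ.word (y 0)) + n) (τ.word (y 0)).length with h | h
          · obtain ⟨h2, rfl⟩ := huniq y hy y' hy' (I (τ.word (y 0)) + n) _ h (hI' _)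
              (by rw [← hxy']; push_cast; rfl)
            omega
          · obtain ⟨h2, rfl⟩ := huniq _ hy1 y' hy'
              (I (τ.word (y 0)) + n - (τ.word (y 0)).length) _
              (by rw [hy10]; omega) (hI' _)
              (by rw [← hxy', hx1]; congr 1; omega)
            rw [hy10] at h2
            omega
      rw [returnWord_eq_iff]
      refine ⟨?_, fun j hj => ?_⟩
      · rw [hret]
        simp only [g, List.length_take, List.length_drop, List.length_append]
        omega
      · simp only [g, List.length_take, List.length_drop, List.length_append] at hj
        simp only [g, List.getElem_take, List.getElem_drop]
        rw [hx, ← τ.apply_of_lt_add y _ (by rw [List.length_append]; omega)]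
        simp only [shiftBy]
        congr 1
        push_cast
        ring
    refine (encard_le_encard hsub).trans ((encard_image_le _ _).trans ?_)
    exact encard_prod.le

/-! ### Central cylinders and the choice of marks -/

variable (X) in
/-- Two points agree on the coordinates from `-n` to `n`. -/
def Agree (n : ℕ) (x y : X.carrier) : Prop :=
  ∀ j : ℤ, -(n : ℤ) ≤ j → j ≤ n → (x : ℤ → B) j = (y : ℤ → B) j

theorem isOpen_setOf_agree [DiscreteTopology B] (n : ℕ) (p : X.carrier) :
    IsOpen {x : X.carrier | X.Agree n x p} := by
  have h : {x : X.carrier | X.Agree n x p} = ⋂ j ∈ Finset.Icc (-(n : ℤ)) n,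
      {x : X.carrier | (x : ℤ → B) j = (p : ℤ → B) j} := by
    ext x
    simp [Agree]
  rw [h]
  refine isOpen_biInter_finset fun j _ => ?_
  have hc : Continuous fun x : X.carrier => (x : ℤ → B) j :=
    (continuous_apply j).comp continuous_subtype_val
  exact (isOpen_discrete {(p : ℤ → B) j}).preimage hc

/-- Every nonempty open set contains a central cylinder. -/
theorem exists_cylinder_subset {C : Set X.carrier} [DiscreteTopology B] (hC : IsOpen C)
    {p : X.carrier} (hp : p ∈ C) : ∃ R : ℕ, ∀ x, X.Agree R x p → x ∈ C := by
  obtain ⟨V, hV, rfl⟩ := isOpen_induced_iff.1 hC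
  obtain ⟨s, u, hu, hsub⟩ := isOpen_pi_iff.1 hV p hp
  refine ⟨s.sup Int.natAbs, fun x hx => hsub fun j hj => ?_⟩
  have hle : j.natAbs ≤ s.sup Int.natAbs := Finset.le_sup (f := Int.natAbs) hj
  rw [hx j (by omega) (by omega)]
  exact (hu j hj).2

/-- The bound is `k * k` with `k` the value of `K`: return words to the marked positions come from
pairs of words. -/
theorem exists_isClopen_of_K_lt_top [Finite B] [DiscreteTopology B]
    (hmin : IsMinimalHomeo X.shift) (hK : X.K < ⊤) :
    ∃ d : ℕ, ∀ C : Set X.carrier, IsOpen C → C.Nonempty →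
      ∃ U : Set X.carrier, IsClopen U ∧ U.Nonempty ∧ U ⊆ C ∧
        (X.returnWord U '' U).encard ≤ d := by
  obtain ⟨k, hk⟩ := ENat.ne_top_iff_exists.1 hK.ne
  refine ⟨k * k, fun C hC ⟨p, hp⟩ => ?_⟩
  obtain ⟨R, hR⟩ := exists_cylinder_subset hC hp
  obtain ⟨M, hM⟩ := hmin.exists_bound (isOpen_setOf_agree R p) ⟨p, fun _ _ _ => rfl⟩
  -- An entry into the cylinder occurs in fewer than `M` steps, and its window has `2 * R + 1`
  -- coordinates, so a word of this length contains the whole window.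
  have hlt : X.minRecognizableCard (M + 2 * R + 1) < k + 1 := by
    have h1 : X.minRecognizableCard (M + 2 * R + 1) ≤ X.K :=
      X.minRecognizableCard_mono.ge_of_tendsto X.tendsto_minRecognizableCard _
    rw [← hk] at h1
    exact h1.trans_lt (by exact_mod_cast Nat.lt_succ_self k)
  simp only [minRecognizableCard, iInf_lt_iff] at hlt
  obtain ⟨W, hWsub, hWrec, hWcard⟩ := hlt
  have hpos : ∀ w ∈ W, ∃ i : ℕ, i < w.length ∧ ∀ x : X.carrier,
      (∀ (j : ℕ) (hj : j < w.length), (x : ℤ → B) j = w[j]) → (X.shift ^ (i : ℤ)) x ∈ C := by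
    intro w hw
    obtain ⟨⟨x, hx, l, hxw⟩, hlen⟩ := hWsub hw
    obtain ⟨i, hi, hiC⟩ := hM ((X.shift ^ (l + R)) ⟨x, hx⟩)
    refine ⟨i + R, by omega, fun z hz => hR _ fun j hj1 hj2 => ?_⟩
    rw [← hiC j hj1 hj2]
    simp only [shift_zpow_apply]
    have h1 := hz (j + i + R).toNat (by omega)
    have h2 := hxw (j + i + R).toNat (by omega)
    rw [← h2, Int.toNat_of_nonneg (by omega)] at h1
    convert h1 using 2 <;> push_cast <;> ring
  choose! I hI hIC using hpos
  obtain ⟨U, hU1, hU2, hU3, hU4⟩ := hWrec.exists_isClopen ⟨p, p.2⟩ hmin I hI hIC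
  have hWk : W.encard ≤ k := Order.le_of_lt_add_one hWcard
  refine ⟨U, hU1, hU2, hU3, hU4.trans ?_⟩
  push_cast
  exact mul_le_mul' hWk hWk

end Subshift

/-! ## The path space -/

namespace OrderedBratteliDiagram

variable (D : OrderedBratteliDiagram)

instance : T2Space D.PathSpace := by
  let _ : ∀ n, TopologicalSpace (D.E n) := fun _ => ⊥
  have : ∀ n, DiscreteTopology (D.E n) := fun _ => ⟨rfl⟩
  exact T2Space.of_injective_continuous (f := PathSpace.edge)
    (fun x y h => PathSpace.ext h) continuous_induced_dom

theorem isLocallyConstant_edge (n : ℕ) : IsLocallyConstant fun w : D.PathSpace => w.edge n := by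
  let _ : ∀ n, TopologicalSpace (D.E n) := fun _ => ⊥
  have : ∀ n, DiscreteTopology (D.E n) := fun _ => ⟨rfl⟩
  exact (IsLocallyConstant.iff_continuous _).2
    ((continuous_apply n).comp continuous_induced_dom)

end OrderedBratteliDiagram

/-! ## The Bratteli diagram of a nested sequence of towers -/

/-- A nested sequence of clopen sets that shrinks to a point, together with locally constant labels
that determine the return times and the itineraries in the previous level. -/
structure NestedTowers {Z : Type*} [TopologicalSpace Z] (T : Z ≃ₜ Z) where
  base : ℕ → Set Z
  label : ℕ → Z → ℕ
  point : Z
  base_zero : base 0 = univ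
  label_zero : ∀ x, label 0 x = 0
  isClopen : ∀ n, IsClopen (base n)
  base_succ_subset : ∀ n, base (n + 1) ⊆ base n
  isBirecurrent : ∀ n, IsBirecurrent T (base n)
  isLocallyConstant_label : ∀ n, IsLocallyConstant (label n)
  retTime_eq : ∀ {n x y}, x ∈ base n → y ∈ base n → label n x = label n y →
    retTime T (base n) x = retTime T (base n) y
  itinerary : ∀ {n x y}, x ∈ base (n + 1) → y ∈ base (n + 1) → label (n + 1) x = label (n + 1) y →
    ∀ p < retTime T (base (n + 1)) x, ((T ^ (p : ℤ)) x ∈ base n ↔ (T ^ (p : ℤ)) y ∈ base n) ∧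
      label n ((T ^ (p : ℤ)) x) = label n ((T ^ (p : ℤ)) y)
  mem_base_iff : ∀ x, (∀ n, x ∈ base n) ↔ x = point
  separates : ∀ x y, (∀ n, backTime T (base n) x = backTime T (base n) y) →
    (∀ n, label n (lastVisit T (base n) x) = label n (lastVisit T (base n) y)) → x = y

namespace NestedTowers

variable {Z : Type*} [TopologicalSpace Z] {T : Z ≃ₜ Z} (K : NestedTowers T)

theorem antitone_base : Antitone K.base := antitone_nat_of_succ_le K.base_succ_subset

/-- The vertices of level `n`. -/
abbrev Vertex (n : ℕ) : Type := K.label n '' K.base n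

/-- The edges between the levels `n` and `n + 1`: the visits to the base of level `n` in the towers
of level `n + 1`. -/
def Edge (n : ℕ) : Type :=
  {e : K.Vertex (n + 1) × ℕ // ∃ x ∈ K.base (n + 1), K.label (n + 1) x = e.1 ∧
    e.2 < retTime T (K.base (n + 1)) x ∧ (T ^ (e.2 : ℤ)) x ∈ K.base n}

variable {K} in
/-- The range of an edge. -/
def Edge.tgt {n : ℕ} (e : K.Edge n) : K.Vertex (n + 1) := e.1.1

variable {K} in
/-- The height of an edge in the tower of its range. -/
def Edge.height {n : ℕ} (e : K.Edge n) : ℕ := e.1.2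

variable {K} in
/-- The source of an edge. -/
noncomputable def Edge.src {n : ℕ} (e : K.Edge n) : K.Vertex n :=
  ⟨K.label n ((T ^ (e.height : ℤ)) e.2.choose), mem_image_of_mem _ e.2.choose_spec.2.2.2⟩

variable {K} in
theorem Edge.ext {n : ℕ} {e f : K.Edge n} (h1 : e.tgt = f.tgt) (h2 : e.height = f.height) :
    e = f :=
  Subtype.ext (Prod.ext h1 h2)

variable {K} in
-- The source was defined through a chosen representative; the itinerary axiom makes it independent
-- of that choice.
theorem Edge.spec {n : ℕ} (e : K.Edge n) {x : Z} (hx : x ∈ K.base (n + 1))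
    (hl : K.label (n + 1) x = e.tgt) : e.height < retTime T (K.base (n + 1)) x ∧
      (T ^ (e.height : ℤ)) x ∈ K.base n ∧ (e.src : ℕ) = K.label n ((T ^ (e.height : ℤ)) x) := by
  obtain ⟨h1, h2, h3, h4⟩ := e.2.choose_spec
  have h5 := K.retTime_eq h1 hx (h2.trans hl.symm)
  have h6 := K.itinerary h1 hx (h2.trans hl.symm) _ h3
  exact ⟨h5 ▸ h3, h6.1.1 h4, h6.2⟩

/-- The edge of the visit at time `p` of a point of the base. -/
def mkEdge {n p : ℕ} {x : Z} (hx : x ∈ K.base (n + 1)) (hp : p < retTime T (K.base (n + 1)) x)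
    (hpx : (T ^ (p : ℤ)) x ∈ K.base n) : K.Edge n :=
  ⟨(⟨K.label (n + 1) x, mem_image_of_mem _ hx⟩, p), x, hx, rfl, hp, hpx⟩

instance (n : ℕ) : PartialOrder (K.Edge n) where
  le e f := e.tgt = f.tgt ∧ e.height ≤ f.height
  le_refl e := ⟨rfl, le_rfl⟩
  le_trans e f g h1 h2 := ⟨h1.1.trans h2.1, h1.2.trans h2.2⟩
  le_antisymm e f h1 h2 := Edge.ext h1.1 (le_antisymm h1.2 h2.2)

variable {K} in
theorem Edge.le_def {n : ℕ} {e f : K.Edge n} : e ≤ f ↔ e.tgt = f.tgt ∧ e.height ≤ f.height :=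
  Iff.rfl

variable {K} in
theorem Edge.lt_iff {n : ℕ} {e f : K.Edge n} : e < f ↔ e.tgt = f.tgt ∧ e.height < f.height := by
  rw [lt_iff_le_not_ge, Edge.le_def, Edge.le_def]
  constructor
  · rintro ⟨⟨h1, h2⟩, h3⟩
    exact ⟨h1, lt_of_not_ge fun h => h3 ⟨h1.symm, h⟩⟩
  · rintro ⟨h1, h2⟩
    exact ⟨⟨h1, h2.le⟩, fun h => absurd h.2 (not_le.2 h2)⟩

variable {K} in
theorem Edge.isMin_iff {n : ℕ} {e : K.Edge n} : IsMin e ↔ e.height = 0 := by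
  constructor
  · intro h
    obtain ⟨x, hx, hl⟩ := e.tgt.2
    have h0 : (K.mkEdge hx ((K.isBirecurrent _).retTime_pos x)
        (by simpa using K.base_succ_subset n hx)) ≤ e := ⟨Subtype.ext hl, Nat.zero_le _⟩
    exact Nat.le_zero.1 (h h0).2
  · exact fun h f hf => ⟨hf.1.symm, h ▸ Nat.zero_le _⟩

instance (n : ℕ) [CompactSpace Z] : Finite (K.Vertex n) :=
  ((K.isLocallyConstant_label n).range_finite.subset (image_subset_range _ _)).to_subtype

instance (n : ℕ) [CompactSpace Z] : Finite (K.Edge n) := by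
  choose x hx hl using fun v : K.Vertex (n + 1) => v.2
  let g : K.Edge n → Σ v : K.Vertex (n + 1), Fin (retTime T (K.base (n + 1)) (x v)) :=
    fun e => ⟨e.tgt, e.height, (e.spec (hx _) (hl _)).1⟩
  refine Finite.of_injective g fun e f h => ?_
  have h1 : e.tgt = f.tgt := congrArg Sigma.fst h
  have h2 : ((g e).2 : ℕ) = (g f).2 := by rw [h]
  exact Edge.ext h1 h2

/-! ### The path of a point and the action of `T` on it -/

/-- The tower that contains a point. -/
noncomputable def cell (n : ℕ) (x : Z) : K.Vertex n :=
  ⟨K.label n (lastVisit T (K.base n) x), mem_image_of_mem _ ((K.isBirecurrent n).lastVisit_mem x)⟩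

theorem backTime_le_succ (n : ℕ) (x : Z) :
    backTime T (K.base n) x ≤ backTime T (K.base (n + 1)) x :=
  backTime_le (K.base_succ_subset n ((K.isBirecurrent _).lastVisit_mem x))

theorem zpow_sub_lastVisit (n : ℕ) (x : Z) :
    (T ^ ((backTime T (K.base (n + 1)) x - backTime T (K.base n) x : ℕ) : ℤ))
      (lastVisit T (K.base (n + 1)) x) = lastVisit T (K.base n) x := by
  rw [Nat.cast_sub (K.backTime_le_succ n x), lastVisit, T.zpow_zpow_apply rfl, lastVisit]
  congr 2
  ring

/-- The edge between the levels `n` and `n + 1` in the path of a point. -/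
noncomputable def edgeAt (n : ℕ) (x : Z) : K.Edge n :=
  K.mkEdge ((K.isBirecurrent (n + 1)).lastVisit_mem x)
    ((Nat.sub_le _ _).trans_lt ((K.isBirecurrent (n + 1)).backTime_lt_retTime x))
    (by rw [K.zpow_sub_lastVisit n x]; exact (K.isBirecurrent n).lastVisit_mem x)

theorem tgt_edgeAt (n : ℕ) (x : Z) : (K.edgeAt n x).tgt = K.cell (n + 1) x := rfl

theorem height_edgeAt (n : ℕ) (x : Z) : (K.edgeAt n x).height =
    backTime T (K.base (n + 1)) x - backTime T (K.base n) x := rfl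

theorem src_edgeAt (n : ℕ) (x : Z) : (K.edgeAt n x).src = K.cell n x := by
  refine Subtype.ext ?_
  rw [((K.edgeAt n x).spec ((K.isBirecurrent (n + 1)).lastVisit_mem x) rfl).2.2, height_edgeAt,
    zpow_sub_lastVisit]
  rfl

theorem isLocallyConstant_edgeAt (n : ℕ) : IsLocallyConstant (K.edgeAt n) := by
  have hb : ∀ n, IsLocallyConstant (backTime T (K.base n)) := fun n =>
    (K.isBirecurrent n).isLocallyConstant_backTime (K.isClopen n)
  have hl : IsLocallyConstant fun x => K.label (n + 1) (lastVisit T (K.base (n + 1)) x) :=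
    (K.isLocallyConstant_label (n + 1)).comp_continuous
      ((K.isBirecurrent _).continuous_lastVisit (K.isClopen _))
  rw [IsLocallyConstant.iff_eventually_eq]
  intro x
  filter_upwards [(hb n).eventually_eq x, (hb (n + 1)).eventually_eq x, hl.eventually_eq x]
    with y h1 h2 h3
  refine Edge.ext (Subtype.ext h3) ?_
  rw [height_edgeAt, height_edgeAt, h1, h2]

theorem isMin_edgeAt {n : ℕ} {x : Z} (hx : x ∈ K.base (n + 1)) : IsMin (K.edgeAt n x) := by
  rw [Edge.isMin_iff, height_edgeAt, backTime_eq_zero hx, Nat.zero_sub]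

theorem zpow_succ_lastVisit (n : ℕ) (x : Z) :
    (T ^ ((backTime T (K.base n) x + 1 : ℕ) : ℤ)) (lastVisit T (K.base n) x) = T x := by
  rw [Nat.cast_add, add_comm, Nat.cast_one, T.zpow_add_apply, zpow_backTime_lastVisit, zpow_one]

/-- There is no visit between the last visit and the present. -/
theorem height_notMem {n : ℕ} {x : Z} (e : K.Edge n) (he : e.tgt = K.cell (n + 1) x)
    (h1 : (K.edgeAt n x).height < e.height) :
    backTime T (K.base (n + 1)) x < e.height := by
  by_contra hcon
  rw [not_lt] at hcon
  rw [height_edgeAt] at h1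
  have h2 := (e.spec ((K.isBirecurrent (n + 1)).lastVisit_mem x)
    (congrArg Subtype.val he.symm)).2.1
  rw [lastVisit, T.zpow_zpow_apply
    (c := -((backTime T (K.base (n + 1)) x - e.height : ℕ) : ℤ)) (by omega)] at h2
  have h3 := backTime_le h2
  have h4 := K.backTime_le_succ n x
  omega

/-- Since `T x` is in the base of level `n`, it either continues the tower of level `n + 1`, giving
a higher edge, or starts a new one, so that no later visit is left in the tower. -/
theorem isMax_edgeAt_iff {n : ℕ} {x : Z} (hx : T x ∈ K.base n) :
    IsMax (K.edgeAt n x) ↔ T x ∈ K.base (n + 1) := by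
  have hrec := K.isBirecurrent (n + 1)
  have hb := hrec.backTime_lt_retTime x
  constructor
  · intro h
    by_contra hcon
    have hne : retTime T (K.base (n + 1)) (lastVisit T (K.base (n + 1)) x) ≠
        backTime T (K.base (n + 1)) x + 1 := by
      intro heq
      have h1 := hrec.zpow_retTime_mem (lastVisit T (K.base (n + 1)) x)
      rw [heq, zpow_succ_lastVisit] at h1
      exact hcon h1
    have hle : K.edgeAt n x ≤ K.mkEdge (hrec.lastVisit_mem x)
        (p := backTime T (K.base (n + 1)) x + 1) (by omega)
        (by rw [zpow_succ_lastVisit]; exact hx) :=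
      ⟨rfl, (Nat.sub_le _ _).trans (Nat.le_succ _)⟩
    have h2 := (h hle).2
    change backTime T (K.base (n + 1)) x + 1 ≤ _ at h2
    rw [height_edgeAt] at h2
    omega
  · intro h e he
    by_contra hcon
    have hlt : (K.edgeAt n x).height < e.height :=
      lt_of_not_ge fun hge => hcon ⟨he.1.symm, hge⟩
    have h1 := K.height_notMem e he.1.symm hlt
    have h2 := (e.spec (hrec.lastVisit_mem x) (congrArg Subtype.val he.1)).1
    have h3 : retTime T (K.base (n + 1)) (lastVisit T (K.base (n + 1)) x) ≤
        backTime T (K.base (n + 1)) x + 1 :=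
      retTime_le (Nat.succ_pos _) (by rw [zpow_succ_lastVisit]; exact h)
    omega

theorem apply_mem_base_iff (n : ℕ) (x : Z) :
    T x ∈ K.base n ↔ ∀ m < n, IsMax (K.edgeAt m x) := by
  constructor
  · intro h m hm
    have hm1 : T x ∈ K.base (m + 1) := K.antitone_base hm h
    exact (K.isMax_edgeAt_iff (K.base_succ_subset m hm1)).2 hm1
  · intro h
    induction n with
    | zero => exact K.base_zero ▸ mem_univ _
    | succ n ih =>
      exact (K.isMax_edgeAt_iff (ih fun m hm => h m (by omega))).1 (h n n.lt_succ_self)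

/-- The action of `T` on the path of a point whose first non-maximal edge has index `n`. -/
theorem edgeAt_apply {n : ℕ} {x : Z} (hlt : ∀ m < n, IsMax (K.edgeAt m x))
    (hn : ¬ IsMax (K.edgeAt n x)) :
    K.edgeAt n x ⋖ K.edgeAt n (T x) ∧ (∀ m < n, IsMin (K.edgeAt m (T x))) ∧
      ∀ m, n < m → K.edgeAt m (T x) = K.edgeAt m x := by
  have hmem : T x ∈ K.base n := (K.apply_mem_base_iff n x).2 hlt
  have hnot : ∀ m, n < m → T x ∉ K.base m := fun m hm h =>
    hn ((K.apply_mem_base_iff m x).1 h n hm)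
  have hback : ∀ m, n < m →
      backTime T (K.base m) (T x) = backTime T (K.base m) x + 1 := fun m hm =>
    (K.isBirecurrent m).backTime_apply (hnot m hm)
  have hcell : ∀ m, n < m → K.cell m (T x) = K.cell m x := fun m hm => by
    refine Subtype.ext ?_
    simp only [cell]
    rw [(K.isBirecurrent m).lastVisit_apply (hnot m hm)]
  have hh : (K.edgeAt n (T x)).height = backTime T (K.base (n + 1)) x + 1 := by
    rw [height_edgeAt, hback _ n.lt_succ_self, backTime_eq_zero hmem, Nat.sub_zero]
  refine ⟨⟨Edge.lt_iff.2 ⟨(hcell _ n.lt_succ_self).symm, ?_⟩, ?_⟩, fun m hm => ?_, fun m hm => ?_⟩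
  · rw [hh, height_edgeAt]
    omega
  · intro e he he'
    rw [Edge.lt_iff] at he he'
    have := K.height_notMem e he.1.symm he.2
    omega
  · exact K.isMin_edgeAt (K.antitone_base (Nat.succ_le_of_lt hm) hmem)
  · refine Edge.ext (hcell (m + 1) (by omega)) ?_
    rw [height_edgeAt, height_edgeAt, hback m hm, hback (m + 1) (by omega)]
    omega

theorem isMin_toPath_iff (x : Z) : (∀ n, IsMin (K.edgeAt n x)) ↔ x = K.point := by
  rw [← K.mem_base_iff]
  constructor
  · intro h
    -- Heights are differences of consecutive back times, and the back time at level `0` vanishes.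
    have hb : ∀ n, backTime T (K.base n) x = 0 := by
      intro n
      induction n with
      | zero => exact backTime_eq_zero (K.base_zero ▸ mem_univ x)
      | succ n ih =>
        have h1 := Edge.isMin_iff.1 (h n)
        rw [height_edgeAt] at h1
        omega
    intro n
    have := (K.isBirecurrent n).lastVisit_mem x
    rwa [lastVisit, hb n] at this
  · exact fun h n => K.isMin_edgeAt (h (n + 1))

theorem isMax_toPath_iff (x : Z) : (∀ n, IsMax (K.edgeAt n x)) ↔ T x = K.point := by
  rw [← K.mem_base_iff]
  exact ⟨fun h n => (K.apply_mem_base_iff n x).2 fun m _ => h m,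
    fun h n => (K.apply_mem_base_iff (n + 1) x).1 (h _) n n.lt_succ_self⟩

/-! ### The diagram and its conjugacy with `T` -/

variable [CompactSpace Z]

/-- The ordered Bratteli diagram of a nested sequence of towers. -/
noncomputable def diagram : OrderedBratteliDiagram where
  V := K.Vertex
  E := K.Edge
  finite_V := inferInstance
  finite_E := inferInstance
  card_V_zero := by
    have : K.label 0 '' K.base 0 = {0} := by
      rw [K.base_zero]
      refine eq_singleton_iff_unique_mem.2 ⟨⟨K.point, trivial, K.label_zero _⟩, ?_⟩
      rintro _ ⟨x, -, rfl⟩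
      exact K.label_zero x
    rw [Vertex, this]
    simp
  source := Edge.src
  range := Edge.tgt
  source_surjective := by
    rintro n ⟨_, z, hz, rfl⟩
    refine ⟨K.edgeAt n z, ?_⟩
    rw [src_edgeAt]
    refine Subtype.ext ?_
    simp only [cell]
    rw [lastVisit_eq_self hz]
  range_surjective := by
    rintro n ⟨_, z, hz, rfl⟩
    refine ⟨K.edgeAt n z, Subtype.ext ?_⟩
    simp only [tgt_edgeAt, cell]
    rw [lastVisit_eq_self hz]
  order := inferInstance
  comparable_iff := by
    intro n e f
    constructor
    · rintro (h | h)
      · exact h.1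
      · exact h.1.symm
    · intro h
      rcases le_total e.height f.height with h' | h'
      · exact Or.inl ⟨h, h'⟩
      · exact Or.inr ⟨h.symm, h'⟩

/-- The path of a point. -/
noncomputable def toPath (x : Z) : K.diagram.PathSpace where
  edge n := K.edgeAt n x
  range_edge n := (K.src_edgeAt (n + 1) x).symm

theorem toPath_edge (x : Z) (n : ℕ) : (K.toPath x).edge n = K.edgeAt n x := rfl

theorem continuous_toPath : Continuous K.toPath := by
  refine continuous_induced_rng.2 ?_
  let _ : ∀ n, TopologicalSpace (K.diagram.E n) := fun _ => ⊥
  refine continuous_pi fun n => ?_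
  let _ : TopologicalSpace (K.Edge n) := ⊥
  exact (K.isLocallyConstant_edgeAt n).continuous

theorem injective_toPath : Function.Injective K.toPath := by
  intro x y h
  have he : ∀ n, K.edgeAt n x = K.edgeAt n y := fun n => by
    rw [← toPath_edge, h, toPath_edge]
  have h0 : ∀ z, backTime T (K.base 0) z = 0 := fun z =>
    backTime_eq_zero (K.base_zero ▸ mem_univ z)
  have hb : ∀ n, backTime T (K.base n) x = backTime T (K.base n) y := by
    intro n
    induction n with
    | zero => rw [h0, h0]
    | succ n ih =>
      have h1 := congrArg Edge.height (he n)
      rw [height_edgeAt, height_edgeAt] at h1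
      have h2 := K.backTime_le_succ n x
      have h3 := K.backTime_le_succ n y
      omega
  refine K.separates x y hb fun n => ?_
  have h1 : K.cell n x = K.cell n y := by rw [← src_edgeAt, ← src_edgeAt, he]
  exact congrArg Subtype.val h1

/-- Every finite path is the start of the path of a point. -/
theorem exists_prefix (w : K.diagram.PathSpace) (n : ℕ) :
    ∀ z ∈ K.base n, K.label n z = (Edge.src (w.edge n) : K.Vertex n) →
      ∃ k : ℕ, k < retTime T (K.base n) z ∧
        ∀ i < n, K.edgeAt i ((T ^ (k : ℤ)) z) = w.edge i := by
  induction n with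
  | zero => exact fun z _ _ => ⟨0, (K.isBirecurrent 0).retTime_pos z, by simp⟩
  | succ n ih =>
    intro z hz hlz
    have hw : Edge.tgt (w.edge n) = Edge.src (w.edge (n + 1)) := w.range_edge n
    have hlz' : K.label (n + 1) z = Edge.tgt (w.edge n) := by rw [hw]; exact hlz
    obtain ⟨hp, hpz, hsrc⟩ := Edge.spec (w.edge n) hz hlz'
    obtain ⟨k, hk, hki⟩ := ih _ hpz hsrc.symm
    generalize hpdef : Edge.height (w.edge n) = p at *
    have hkp : (T ^ (k : ℤ)) ((T ^ (p : ℤ)) z) = (T ^ ((p + k : ℕ) : ℤ)) z :=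
      T.zpow_zpow_apply (by push_cast; ring) z
    -- A return to the smaller base is also a visit to the larger one, which does not occur within
    -- `k` steps after time `p`.
    have hlt : p + k < retTime T (K.base (n + 1)) z := by
      by_contra hcon
      have h1 := (K.isBirecurrent (n + 1)).zpow_retTime_mem z
      refine zpow_notMem_of_lt_retTime (T := T) (U := K.base n) (x := (T ^ (p : ℤ)) z)
        (n := retTime T (K.base (n + 1)) z - p) (by omega) (by omega) ?_
      rw [T.zpow_zpow_apply (c := (retTime T (K.base (n + 1)) z : ℤ)) (by omega)]
      exact K.base_succ_subset n h1
    refine ⟨p + k, hlt, fun i hi => ?_⟩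
    rcases Nat.lt_succ_iff_lt_or_eq.1 hi with h | rfl
    · rw [← hkp]
      exact hki i h
    · refine Edge.ext ?_ ?_
      · refine Subtype.ext ?_
        rw [tgt_edgeAt]
        simp only [cell]
        rw [(K.isBirecurrent _).lastVisit_zpow hz hlt, hlz']
      · rw [height_edgeAt, (K.isBirecurrent _).backTime_zpow hz hlt, ← hkp,
          (K.isBirecurrent _).backTime_zpow hpz hk, hpdef]
        omega

/-- Each finite prefix is realized by `exists_prefix`; compactness realizes the whole path. -/
theorem surjective_toPath : Function.Surjective K.toPath := by
  intro w
  have hc : ∀ i, IsClosed {x | K.edgeAt i x = w.edge i} := fun i =>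
    (K.isLocallyConstant_edgeAt i).isClosed_fiber _
  have hne : (⋂ n, ⋂ i ∈ Finset.range n, {x | K.edgeAt i x = w.edge i}).Nonempty := by
    have hcl : ∀ n, IsClosed (⋂ i ∈ Finset.range n, {x | K.edgeAt i x = w.edge i}) := fun n =>
      isClosed_biInter fun i _ => hc i
    refine IsCompact.nonempty_iInter_of_sequence_nonempty_isCompact_isClosed _ ?_ ?_
      (hcl 0).isCompact hcl
    · intro n x hx
      simp only [mem_iInter] at hx ⊢
      exact fun i hi => hx i (Finset.range_mono n.le_succ hi)
    · intro n
      obtain ⟨z, hz, hlz⟩ := (Edge.src (w.edge n) : K.Vertex n).2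
      obtain ⟨k, -, hk⟩ := K.exists_prefix w n z hz hlz
      refine ⟨(T ^ (k : ℤ)) z, ?_⟩
      simp only [mem_iInter, Finset.mem_range]
      exact hk
  obtain ⟨x, hx⟩ := hne
  simp only [mem_iInter] at hx
  refine ⟨x, OrderedBratteliDiagram.PathSpace.ext (funext fun n => ?_)⟩
  exact hx (n + 1) n (Finset.self_mem_range_succ n)

theorem isProperlyOrdered_diagram : K.diagram.IsProperlyOrdered := by
  constructor
  · refine ⟨K.toPath (T.symm K.point), (K.isMax_toPath_iff _).2 (T.apply_symm_apply _), ?_⟩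
    intro w hw
    obtain ⟨x, rfl⟩ := K.surjective_toPath w
    rw [← (K.isMax_toPath_iff x).1 hw, T.symm_apply_apply]
  · refine ⟨K.toPath K.point, (K.isMin_toPath_iff _).2 rfl, ?_⟩
    intro w hw
    obtain ⟨x, rfl⟩ := K.surjective_toPath w
    rw [(K.isMin_toPath_iff x).1 hw]

theorem connected_cell (x : Z) (n N : ℕ) (h : n ≤ N) :
    K.diagram.Connected (n := n) (K.cell n x) N (K.cell N x) := by
  induction N, h using Nat.le_induction with
  | base => exact .refl
  | succ N _ ih =>
    refine .step (D := K.diagram) (K.edgeAt N x) ?_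
    change K.diagram.Connected _ N (K.edgeAt N x).src
    rw [src_edgeAt]
    exact ih

/-- Every orbit segment of some bounded length meets the base of each tower of level `n`, and at
high levels all towers are at least that tall. -/
theorem isSimple_diagram [T2Space Z] [Infinite Z] (hT : IsMinimalHomeo T) :
    K.diagram.IsSimple := by
  intro n _
  have hM : ∀ u : K.Vertex n, ∃ M : ℕ, ∀ x, ∃ i : ℕ, i < M ∧
      (T ^ (i : ℤ)) x ∈ K.base n ∩ {z | K.label n z = u} := by
    rintro ⟨_, z, hz, rfl⟩
    exact hT.exists_bound
      ((K.isClopen n).isOpen.inter ((K.isLocallyConstant_label n).isOpen_fiber _)) ⟨z, hz, rfl⟩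
  choose M hM using hM
  cases nonempty_fintype (K.Vertex n)
  obtain ⟨N, hN⟩ := exists_retTime_ge (fun n => (K.isClopen n).isClosed) K.antitone_base
    K.isBirecurrent (fun x => (K.mem_base_iff x).1) (fun n hn => hT.zpow_ne_self hn K.point)
    (Finset.univ.sup M)
  refine ⟨max N (n + 1), by omega, fun (u : K.Vertex n) v => ?_⟩
  obtain ⟨z, hz, hv⟩ : ∃ z ∈ K.base (max N (n + 1)), K.label _ z = (show K.Vertex _ from v) := (show K.Vertex _ from v).2
  obtain ⟨i, hi, hi1, hi2⟩ := hM u z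
  have hret := hN _ (le_max_left N (n + 1)) z hz
  have hMu : M u ≤ Finset.univ.sup M := Finset.le_sup (f := M) (Finset.mem_univ u)
  have hc := K.connected_cell ((T ^ (i : ℤ)) z) n (max N (n + 1)) (by omega)
  have h1 : K.cell n ((T ^ (i : ℤ)) z) = u := by
    refine Subtype.ext ?_
    simp only [cell]
    rw [lastVisit_eq_self hi1]
    exact hi2
  have h2 : K.cell (max N (n + 1)) ((T ^ (i : ℤ)) z) = v := by
    refine Subtype.ext ?_
    simp only [cell]
    rw [(K.isBirecurrent _).lastVisit_zpow hz (by omega)]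
    exact hv
  rwa [h1, h2] at hc

theorem isRepresentation_diagram [T2Space Z] [Infinite Z] (hT : IsMinimalHomeo T) :
    K.diagram.IsRepresentation T := by
  refine ⟨K.isSimple_diagram hT, K.isProperlyOrdered_diagram, ?_⟩
  let e : Z ≃ K.diagram.PathSpace :=
    Equiv.ofBijective K.toPath ⟨K.injective_toPath, K.surjective_toPath⟩
  let φ : Z ≃ₜ K.diagram.PathSpace :=
    Continuous.homeoOfEquivCompactToT2 (f := e) K.continuous_toPath
  -- The transported map has the defining property of the Vershik map, so uniqueness identifies the
  -- two.
  have hV : K.diagram.IsVershikMap fun w => φ (T (φ.symm w)) := by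
    constructor
    · intro w hw
      obtain ⟨x, rfl⟩ := φ.surjective w
      simp only [φ.symm_apply_apply]
      exact (K.isMin_toPath_iff _).2 ((K.isMax_toPath_iff x).1 hw)
    · intro w n hlt hn
      obtain ⟨x, rfl⟩ := φ.surjective w
      simp only [φ.symm_apply_apply]
      exact K.edgeAt_apply hlt hn
  refine ⟨φ, fun x => ?_⟩
  have h1 := (K.diagram.existsUnique_isVershikMap K.isProperlyOrdered_diagram).unique
    (K.diagram.isVershikMap_vershikMap K.isProperlyOrdered_diagram) hV
  simp only [h1, φ.symm_apply_apply]

end NestedTowers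

/-! ## Subshifts with clopen sets with few return words have finite topological rank -/

namespace Subshift

variable {B : Type*} [TopologicalSpace B] {X : Subshift B}

theorem exists_agree_factor [Finite B] [DiscreteTopology B] {α : Type*} {f : X.carrier → α}
    (hf : IsLocallyConstant f) : ∃ N, ∀ n, N ≤ n → ∀ x y, X.Agree n x y → f x = f y := by
  refine hf.exists_factor (r := X.Agree) (fun n => ?_) (fun n x y h j h1 h2 => ?_)
    fun x y h => Subtype.ext (funext fun j => ?_)
  · simp only [Agree, ofPred_forall]
    refine isClosed_iInter fun j => isClosed_iInter fun _ => isClosed_iInter fun _ => ?_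
    exact isClosed_eq
      ((continuous_apply j).comp (continuous_subtype_val.comp continuous_fst))
      ((continuous_apply j).comp (continuous_subtype_val.comp continuous_snd))
  · exact h j (by push_cast; omega) (by push_cast; omega)
  · exact h j.natAbs j (by omega) (by omega)

/-- If the points of `U` agree around the origin, then points of `U` with the same return word also
agree around the whole word. -/
theorem eq_of_returnWord_eq {U : Set X.carrier} (hrec : IsBirecurrent X.shift U) {R : ℕ}
    (hR : ∀ x ∈ U, ∀ y ∈ U, X.Agree R x y) {x y : X.carrier} (hx : x ∈ U) (hy : y ∈ U)
    (h : X.returnWord U x = X.returnWord U y) {j : ℤ} (h1 : -(R : ℤ) ≤ j)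
    (h2 : j ≤ retTime X.shift U x + R) : (x : ℤ → B) j = (y : ℤ → B) j := by
  have hret : retTime X.shift U x = retTime X.shift U y := by
    rw [← length_returnWord, h, length_returnWord]
  rcases le_or_gt j R with h3 | h3
  · exact hR x hx y hy j h1 h3
  rcases lt_or_ge j (retTime X.shift U x) with h4 | h4
  · lift j to ℕ using by omega
    have h5 : j < (X.returnWord U x).length := by
      rw [length_returnWord]
      exact_mod_cast h4
    rw [← getElem_returnWord X U x j h5, ← getElem_returnWord X U y j (h ▸ h5)]
    simp only [h]
  · have h5 := hR _ (hrec.zpow_retTime_mem x) _ (hrec.zpow_retTime_mem y)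
      (j - retTime X.shift U x) (by omega) (by omega)
    rw [shift_zpow_apply, shift_zpow_apply, ← hret, sub_add_cancel] at h5
    exact h5

theorem hasFiniteTopologicalRank_of_exists_isClopen [Finite B] [DiscreteTopology B]
    (hinf : X.carrier.Infinite) (hmin : IsMinimalHomeo X.shift) {d : ℕ}
    (hd : ∀ C : Set X.carrier, IsOpen C → C.Nonempty → ∃ U : Set X.carrier,
      IsClopen U ∧ U.Nonempty ∧ U ⊆ C ∧ (X.returnWord U '' U).encard ≤ d) :
    HasFiniteTopologicalRank X.shift := by
  have : Infinite X.carrier := hinf.to_subtype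
  have hrec' : ∀ {U : Set X.carrier}, IsClopen U → U.Nonempty → IsBirecurrent X.shift U :=
    fun hU hne => hmin.isBirecurrent hU.isOpen hne
  -- The new set lies in a cylinder of radius `R` around a point of `U`, where windows of radius `R`
  -- decide membership in `U` and the return word; `n ≤ R` makes the sets shrink to a point.
  have hstep : ∀ (n : ℕ) (U : {U : Set X.carrier // IsClopen U ∧ U.Nonempty}),
      ∃ (U' : {U : Set X.carrier // IsClopen U ∧ U.Nonempty}) (R : ℕ), (U' : Set X.carrier) ⊆ U ∧
        (X.returnWord U' '' U').encard ≤ d ∧ n ≤ R ∧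
        (∀ x y, X.Agree R x y → ((x ∈ U.1) = (y ∈ U.1)) ∧
          X.returnWord U x = X.returnWord U y) ∧
        ∀ x ∈ U'.1, ∀ y ∈ U'.1, X.Agree R x y := by
    rintro n ⟨U, hU, p, hp⟩
    have hmemlc : IsLocallyConstant fun x => x ∈ U := by
      rw [IsLocallyConstant.iff_eventually_eq]
      intro x
      filter_upwards [hU.eventually_mem_iff x] with y hy using propext hy
    obtain ⟨N, hN⟩ := exists_agree_factor
      (hmemlc.prodMk (X.isLocallyConstant_returnWord hU (hrec' hU ⟨p, hp⟩)))
    obtain ⟨U', hU', hne', hsub, hcard⟩ := hd _ (isOpen_setOf_agree (max n N) p) ⟨p, fun _ _ _ => rfl⟩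
    refine ⟨⟨U', hU', hne'⟩, max n N, fun x hx => ?_, hcard, le_max_left _ _, fun x y hxy => ?_,
      fun x hx y hy j h1 h2 => ?_⟩
    · have h := congrArg Prod.fst (hN _ (le_max_right _ _) x p (hsub hx))
      exact (cast h.symm hp : x ∈ U)
    · exact Prod.mk_inj.1 (hN _ (le_max_right _ _) x y hxy)
    · exact (hsub hx j h1 h2).trans (hsub hy j h1 h2).symm
  choose next R hnext hcard hnR hfac hagree using hstep
  let V : ℕ → {U : Set X.carrier // IsClopen U ∧ U.Nonempty} := fun n =>
    Nat.rec ⟨univ, isClopen_univ, univ_nonempty⟩ next n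
  let U : ℕ → Set X.carrier := fun n => (V n).1
  have hU : ∀ n, IsClopen (U n) := fun n => (V n).2.1
  have hrec : ∀ n, IsBirecurrent X.shift (U n) := fun n => hrec' (hU n) (V n).2.2
  have hsub : ∀ n, U (n + 1) ⊆ U n := fun n => hnext n (V n)
  let ρ : ℕ → ℕ := fun n => R n (V n)
  have hρ : ∀ n, n ≤ ρ n := fun n => hnR n (V n)
  have hfac' : ∀ n x y, X.Agree (ρ n) x y → ((x ∈ U n) = (y ∈ U n)) ∧
    X.returnWord (U n) x = X.returnWord (U n) y := fun n => hfac n (V n)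
  have hag : ∀ n, ∀ x ∈ U (n + 1), ∀ y ∈ U (n + 1), X.Agree (ρ n) x y := fun n => hagree n (V n)
  obtain ⟨p, hp⟩ : (⋂ n, U n).Nonempty :=
    IsCompact.nonempty_iInter_of_sequence_nonempty_isCompact_isClosed _ hsub
      (fun n => (V n).2.2) (hU 0).isClosed.isCompact fun n => (hU n).isClosed
  rw [mem_iInter] at hp
  -- Words are encoded by natural numbers so that the vertices live in `Type` whatever the universe
  -- of `B`. At level `0` the label is constant, to leave a single vertex.
  obtain ⟨f, hf⟩ := exists_injective_nat (List B)
  let label : ℕ → X.carrier → ℕ := fun n x => if n = 0 then 0 else f (X.returnWord (U n) x)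
  have hlabel : ∀ n x y, label (n + 1) x = label (n + 1) y →
      X.returnWord (U (n + 1)) x = X.returnWord (U (n + 1)) y := by
    intro n x y h
    simp only [label, Nat.succ_ne_zero, if_false] at h
    exact hf h
  let K : NestedTowers X.shift :=
    { base := U
      label := label
      point := p
      base_zero := rfl
      label_zero := fun x => if_pos rfl
      isClopen := hU
      base_succ_subset := hsub
      isBirecurrent := hrec
      isLocallyConstant_label := fun n => by
        rcases eq_or_ne n 0 with rfl | hn
        · exact IsLocallyConstant.of_constant _ fun x y => by simp [label]
        · simp only [label, hn, if_false]
          exact (X.isLocallyConstant_returnWord (hU n) (hrec n)).comp f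
      retTime_eq := fun {n x y} _ _ h => by
        rcases n with _ | n
        · have h1 : ∀ z, retTime X.shift (U 0) z = 1 := fun z =>
            (hrec 0).retTime_eq Nat.one_pos (mem_univ _) fun m hm hm' => by omega
          rw [h1, h1]
        · rw [← length_returnWord, hlabel n x y h, length_returnWord]
      itinerary := fun {n x y} hx hy h q hq => by
        have h1 : X.Agree (ρ n) ((X.shift ^ (q : ℤ)) x) ((X.shift ^ (q : ℤ)) y) := by
          intro j hj1 hj2
          rw [shift_zpow_apply, shift_zpow_apply]
          exact eq_of_returnWord_eq (hrec (n + 1)) (hag n) hx hy (hlabel n x y h) (by omega)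
            (by omega)
        obtain ⟨h2, h3⟩ := hfac' n _ _ h1
        refine ⟨Iff.of_eq h2, ?_⟩
        simp only [label, h3]
      mem_base_iff := fun x => by
        refine ⟨fun hx => Subtype.ext (funext fun j => ?_), fun hx => hx ▸ hp⟩
        have := hρ j.natAbs
        exact hag j.natAbs x (hx (j.natAbs + 1)) p (hp (j.natAbs + 1)) j (by omega) (by omega)
      -- The coordinate `j` is recovered at level `j.natAbs + 1`, where agreement extends at least
      -- `j.natAbs` beyond both ends of the return word.
      separates := fun x y hb hl => Subtype.ext (funext fun j => by
        have h1 := hρ j.natAbs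
        have h2 := (hrec (j.natAbs + 1)).backTime_lt_retTime x
        have h3 := eq_of_returnWord_eq (hrec (j.natAbs + 1)) (hag j.natAbs)
          ((hrec (j.natAbs + 1)).lastVisit_mem x) ((hrec (j.natAbs + 1)).lastVisit_mem y)
          (hlabel _ _ _ (hl (j.natAbs + 1)))
          (j := j + backTime X.shift (U (j.natAbs + 1)) x) (by omega) (by omega)
        rw [← zpow_backTime_lastVisit X.shift (U (j.natAbs + 1)) x,
          ← zpow_backTime_lastVisit X.shift (U (j.natAbs + 1)) y, shift_zpow_apply,
          shift_zpow_apply, h3]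
        exact congrArg (fun b : ℕ => (lastVisit X.shift (U (j.natAbs + 1)) y).1 (j + b))
          (hb (j.natAbs + 1))) }
  refine ⟨K.diagram, max d 1, K.isRepresentation_diagram hmin, fun n => ?_⟩
  rcases n with _ | n
  · rw [K.diagram.card_V_zero]
    exact le_max_right _ _
  · refine le_trans ?_ (le_max_left _ _)
    change Nat.card (label (n + 1) '' U (n + 1)) ≤ d
    have h1 : label (n + 1) '' U (n + 1) = f '' (X.returnWord (U (n + 1)) '' U (n + 1)) := by
      rw [image_image]
      simp only [label, Nat.succ_ne_zero, if_false]
    rw [h1, Nat.card_coe_set_eq, ncard_image_of_injective _ hf]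
    exact ENat.toNat_le_of_le_natCast (hcard n (V n))

end Subshift

/-! ## Finite topological rank gives clopen sets with few return words -/

namespace OrderedBratteliDiagram

variable {D : OrderedBratteliDiagram}

/-- Each vertex receives exactly one minimal edge, so the minimal path is determined downwards from
its end. -/
theorem PathSpace.edge_eq_of_isMin {x y : D.PathSpace} {n : ℕ}
    (h : D.source (x.edge n) = D.source (y.edge n)) (hx : ∀ m < n, IsMin (x.edge m))
    (hy : ∀ m < n, IsMin (y.edge m)) : ∀ m < n, x.edge m = y.edge m := by
  induction n with
  | zero => simp
  | succ n ih =>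
    have hn : x.edge n = y.edge n := D.eq_of_isMin (hx n n.lt_succ_self) (hy n n.lt_succ_self)
      (by rw [x.range_edge, y.range_edge, h])
    intro m hm
    rcases Nat.lt_succ_iff_lt_or_eq.1 hm with h' | rfl
    · exact ih (by rw [hn]) (fun m hm => hx m (by omega)) (fun m hm => hy m (by omega)) m h'
    · exact hn

theorem PathSpace.exists_first_not_isMax {x : D.PathSpace} {N : ℕ}
    (h : ¬ ∀ m < N, IsMax (x.edge m)) :
    ∃ n < N, (∀ m < n, IsMax (x.edge m)) ∧ ¬ IsMax (x.edge n) := by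
  classical
  push Not at h
  have hspec := Nat.find_spec h
  refine ⟨Nat.find h, hspec.1, fun m hm => ?_, hspec.2⟩
  by_contra hmax
  exact Nat.find_min h hm ⟨hm.trans hspec.1, hmax⟩

namespace IsVershikMap

variable {f : D.PathSpace → D.PathSpace}

/-- If the first non-maximal edge is among the first `N`, its replacement covers it and is not
minimal; otherwise the first `N` edges are all reset to minimal ones. -/
theorem isMin_apply_iff (hf : D.IsVershikMap f) (x : D.PathSpace) (N : ℕ) :
    (∀ m < N, IsMin ((f x).edge m)) ↔ ∀ m < N, IsMax (x.edge m) := by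
  constructor
  · intro h
    by_contra hcon
    obtain ⟨n, hnN, hlt, hn⟩ := PathSpace.exists_first_not_isMax hcon
    exact (h n hnN).not_lt (hf.2 x n hlt hn).1.lt
  · intro h m hm
    by_cases hx : ∀ n, IsMax (x.edge n)
    · exact hf.1 x hx m
    · obtain ⟨k, hk⟩ := not_forall.1 hx
      obtain ⟨n, -, hlt, hn⟩ := PathSpace.exists_first_not_isMax (x := x) (N := k + 1)
        fun h => hk (h k k.lt_succ_self)
      refine (hf.2 x n hlt hn).2.1 m (hm.trans_le (not_lt.1 fun h' => hn (h n h')))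

/-- While the first `N` edges are not all maximal, the change takes place among them and depends on
them alone. -/
theorem edge_apply_eq (hf : D.IsVershikMap f) {x y : D.PathSpace} {N : ℕ}
    (h : ∀ m < N, x.edge m = y.edge m) (hx : ¬ ∀ m < N, IsMax (x.edge m)) :
    ∀ m < N, (f x).edge m = (f y).edge m := by
  obtain ⟨n, hnN, hlt, hn⟩ := PathSpace.exists_first_not_isMax hx
  obtain ⟨hx1, hx2, hx3⟩ := hf.2 x n hlt hn
  obtain ⟨hy1, hy2, hy3⟩ := hf.2 y n (fun m hm => h m (hm.trans hnN) ▸ hlt m hm) (h n hnN ▸ hn)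
  have hen : (f x).edge n = (f y).edge n := D.eq_of_covBy hx1 (h n hnN ▸ hy1)
  intro m hm
  rcases lt_trichotomy m n with h' | rfl | h'
  · exact PathSpace.edge_eq_of_isMin (by rw [hen]) hx2 hy2 m h'
  · exact hen
  · rw [hx3 m h', hy3 m h', h m hm]

end IsVershikMap

end OrderedBratteliDiagram

namespace Subshift

variable {B : Type*} [TopologicalSpace B] {X : Subshift B}

theorem K_lt_top_of_hasFiniteTopologicalRank [Finite B] [DiscreteTopology B]
    (hinf : X.carrier.Infinite) (hmin : IsMinimalHomeo X.shift)
    (hrank : HasFiniteTopologicalRank X.shift) : X.K < ⊤ := by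
  have : Infinite X.carrier := hinf.to_subtype
  obtain ⟨D, d, ⟨-, hD, φ, hφ⟩, hcard⟩ := hrank
  have hf := D.isVershikMap_vershikMap hD
  obtain ⟨w, hw, hwuniq⟩ := hD.2
  have hlc : ∀ m, IsLocallyConstant fun x => (φ x).edge m := fun m =>
    (D.isLocallyConstant_edge m).comp_continuous φ.continuous
  let U : ℕ → Set X.carrier := fun N => {x | ∀ m < N, IsMin ((φ x).edge m)}
  have hU : ∀ N, IsClopen (U N) := by
    intro N
    have : U N = ⋂ m ∈ Finset.range N, (fun x => (φ x).edge m) ⁻¹' {e | IsMin e} := by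
      ext x
      simp [U]
    rw [this]
    exact isClopen_biInter_finset fun m _ => ⟨⟨hlc m {e | IsMin e}ᶜ⟩, hlc m _⟩
  have hrec : ∀ N, IsBirecurrent X.shift (U N) := fun N =>
    hmin.isBirecurrent (hU N).isOpen
      ⟨φ.symm w, fun m _ => by rw [φ.apply_symm_apply]; exact hw m⟩
  have hanti : Antitone U := fun N N' h x hx m hm => hx m (hm.trans_le h)
  have hpoint : ∀ x, (∀ N, x ∈ U N) → x = φ.symm w := fun x hx => by
    rw [← hwuniq (φ x) fun m => hx (m + 1) m m.lt_succ_self, φ.symm_apply_apply]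
  have hmem : ∀ N x, X.shift x ∈ U N ↔ ∀ m < N, IsMax ((φ x).edge m) := fun N x => by
    rw [← hf.isMin_apply_iff, ← hφ]
    rfl
  have hsucc : ∀ (j : ℕ) (x : X.carrier),
      (X.shift ^ ((j + 1 : ℕ) : ℤ)) x = X.shift ((X.shift ^ (j : ℤ)) x) := fun j x => by
    rw [Nat.cast_add, add_comm, X.shift.zpow_add_apply, Nat.cast_one, zpow_one]
  -- Points of `U N` with the same vertex at level `N` start with the same minimal edges, and these
  -- evolve identically until the first return.
  have horbit : ∀ N x y, x ∈ U N → y ∈ U N →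
      D.source ((φ x).edge N) = D.source ((φ y).edge N) →
      ∀ j : ℕ, j < retTime X.shift (U N) x → ∀ m < N,
        (φ ((X.shift ^ (j : ℤ)) x)).edge m = (φ ((X.shift ^ (j : ℤ)) y)).edge m := by
    intro N x y hx hy hs j
    induction j with
    | zero => exact fun _ => OrderedBratteliDiagram.PathSpace.edge_eq_of_isMin hs hx hy
    | succ j ih =>
      intro hj
      have hnot := zpow_notMem_of_lt_retTime j.succ_pos hj
      rw [hsucc, hmem] at hnot
      rw [hsucc, hsucc, hφ, hφ]
      exact hf.edge_apply_eq (ih (by omega)) hnot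
  have hret_le : ∀ N x y, x ∈ U N → y ∈ U N →
      D.source ((φ x).edge N) = D.source ((φ y).edge N) →
      retTime X.shift (U N) x ≤ retTime X.shift (U N) y := by
    intro N x y hx hy hs
    by_contra hcon
    rw [not_le] at hcon
    refine zpow_notMem_of_lt_retTime ((hrec N).retTime_pos y) hcon fun m hm => ?_
    rw [horbit N x y hx hy hs _ hcon m hm]
    exact (hrec N).zpow_retTime_mem y m hm
  suffices h : ∀ n, X.minRecognizableCard n ≤ d from
    (le_of_tendsto' X.tendsto_minRecognizableCard h).trans_lt (ENat.natCast_lt_top d)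
  intro n
  obtain ⟨N₁, hN₁⟩ := exists_retTime_ge (fun N => (hU N).isClosed) hanti hrec hpoint
    (fun k hk => hmin.zpow_ne_self hk _) n
  have hlc0 : IsLocallyConstant fun x : X.carrier => (x : ℤ → B) 0 :=
    (IsLocallyConstant.iff_continuous _).2 ((continuous_apply 0).comp continuous_subtype_val)
  -- From level `N₂` on, the first edges determine the coordinate at the origin, so equal evolution
  -- of edges gives equal words.
  obtain ⟨N₂, hN₂⟩ := hlc0.exists_factor
    (r := fun N x y => ∀ m < N, (φ x).edge m = (φ y).edge m)
    (fun N => by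
      simp only [ofPred_forall]
      refine isClosed_iInter fun m => isClosed_iInter fun _ => ?_
      let _ : TopologicalSpace (D.E m) := ⊥
      have : DiscreteTopology (D.E m) := ⟨rfl⟩
      exact isClosed_eq ((hlc m).continuous.comp continuous_fst)
        ((hlc m).continuous.comp continuous_snd))
    (fun N x y h m hm => h m (by omega))
    fun x y h => φ.injective
      (OrderedBratteliDiagram.PathSpace.ext (funext fun m => h (m + 1) m m.lt_succ_self))
  obtain ⟨N, h1, h2⟩ : ∃ N, N₁ ≤ N ∧ N₂ ≤ N := ⟨max N₁ N₂, le_max_left _ _, le_max_right _ _⟩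
  have hword : ∀ x y, x ∈ U N → y ∈ U N → D.source ((φ x).edge N) = D.source ((φ y).edge N) →
      X.returnWord (U N) x = X.returnWord (U N) y := by
    intro x y hx hy hs
    rw [returnWord_eq_iff]
    refine ⟨?_, fun j hj => ?_⟩
    · rw [length_returnWord]
      exact le_antisymm (hret_le N x y hx hy hs) (hret_le N y x hy hx hs.symm)
    · rw [getElem_returnWord]
      rw [length_returnWord] at hj
      have := hN₂ N h2 _ _ (horbit N x y hx hy hs j (hj.trans_le (hret_le N y x hy hx hs.symm)))
      simpa only [shift_zpow_apply, zero_add] using this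
  have hWcard : (X.returnWord (U N) '' U N).encard ≤ d := by
    classical
    -- The return word as a function of the vertex; the empty word is a dummy value at vertices
    -- without a suitable point.
    let F : D.V N → List B := fun v =>
      if h : ∃ x ∈ U N, D.source ((φ x).edge N) = v then X.returnWord (U N) h.choose else []
    have hsub : X.returnWord (U N) '' U N ⊆ F '' univ := by
      rintro _ ⟨x, hx, rfl⟩
      have h : ∃ y ∈ U N, D.source ((φ y).edge N) = D.source ((φ x).edge N) := ⟨x, hx, rfl⟩
      refine ⟨D.source ((φ x).edge N), mem_univ _, ?_⟩
      simp only [F]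
      rw [dif_pos h]
      exact hword _ _ h.choose_spec.1 hx h.choose_spec.2
    refine (encard_le_encard hsub).trans ((encard_image_le _ _).trans ?_)
    rw [encard_univ, ENat.card_eq_coe_natCard]
    exact_mod_cast hcard N
  refine le_trans ?_ hWcard
  refine iInf_le_of_le _ (iInf_le_of_le ?_
    (iInf_le _ (X.recognizableSet_returnWord (hU N) (hrec N))))
  rintro _ ⟨x, hx, rfl⟩
  exact ⟨X.returnWord_mem_language _ x, (X.length_returnWord _ x).symm ▸ hN₁ N h1 x hx⟩

end Subshift

/-! ### The equivalence -/

theorem mainTheorem2 {B : Type*} [Finite B] [TopologicalSpace B] [DiscreteTopology B]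
    (X : Subshift B) (hinf : X.carrier.Infinite) (hmin : IsMinimalHomeo X.shift) :
    HasFiniteTopologicalRank X.shift ↔ X.K < ⊤ := by
  refine ⟨Subshift.K_lt_top_of_hasFiniteTopologicalRank hinf hmin, fun hK => ?_⟩
  obtain ⟨d, hd⟩ := Subshift.exists_isClopen_of_K_lt_top hmin hK
  exact Subshift.hasFiniteTopologicalRank_of_exists_isClopen hinf hmin hd
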